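/- Let $\Gamma$ be a finite simple connected undirected graph with vertex set $V_\Gamma$ and edge set $E_\Gamma$, and let $d_\Gamma$ be its shortest path metric. Assume that $\Gamma$ is modular, i.e. every three vertices $p_1,p_2,p_3$ have a median: a vertex $m$ with $d_\Gamma(p_i,p_j)=d_\Gamma(p_i,m)+d_\Gamma(m,p_j)$ for $1\le i<j\le 3$. Assume also that $\Gamma$ is orientable, i.e. it has an orientation such that for every 4-cycle with edges $uv, vv', v'u', u'u$, the edge $uv$ is oriented from $v$ to $u$ if and only if $u'v'$ is oriented from $v'$ to $u'$. Two edges $e,e'$ are in the same orbit if there is a sequence of edges $e=e_0,e_1,\dots,e_m=e'$ ($m\ge 0$) such that $e_i$ and $e_{i+1}$ belong to a common 4-cycle and share no vertex, for every $i<m$. A function $h:E_\Gamma\to\mathbf R$ is orbit-invariant if it is constant on every orbit. For $h\ge 0$, let $d_{\Gamma,h}$ be the shortest path (pseudo)metric on $V_\Gamma$ with respect to the edge-length $h$. Let $V\supseteq V_\Gamma$ be a finite set with $V\setminus V_\Gamma=\{1,\dots,n\}$, and let $c:\binom{V}{2}\to\mathbf Q_{\ge 0}$ be a nonnegative cost on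 the unordered pairs of distinct elements of $V$. The problem $\mathbf{Multifac}[\Gamma,h;V,c]$ is to minimize $$(c\cdot d_{\Gamma,h})(\rho)=\sum_{s\in V_\Gamma}\sum_{1\le j\le n}c(sj)\,d_{\Gamma,h}(s,\rho_j)+\sum_{1\le i<j\le n}c(ij)\,d_{\Gamma,h}(\rho_i,\rho_j)$$ over all locations $\rho=(\rho_1,\dots,\rho_n)\in (V_\Gamma)^n$; a minimizer is called an optimal location. Write $1$ for the edge-length that equals $1$ on every edge. Then for every nonnegative orbit-invariant function $h:E_\Gamma\to\mathbf R$, every optimal location of $\mathbf{Multifac}[\Gamma,1;V,c]$ is an optimal location of $\mathbf{Multifac}[\Gamma,h;V,c]$. -/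

import Mathlib

namespace ModularGraph

variable {V : Type*}

/-- `m` is a median of `p₁, p₂, p₃`: it lies on a shortest path between any two of them. -/
def IsMedian (Γ : SimpleGraph V) (p₁ p₂ p₃ m : V) : Prop :=
  Γ.dist p₁ p₂ = Γ.dist p₁ m + Γ.dist m p₂ ∧
  Γ.dist p₂ p₃ = Γ.dist p₂ m + Γ.dist m p₃ ∧
  Γ.dist p₁ p₃ = Γ.dist p₁ m + Γ.dist m p₃

/-- A graph is modular if every triple of vertices has a median. -/
def IsModular (Γ : SimpleGraph V) : Prop :=
  ∀ p₁ p₂ p₃ : V, ∃ m : V, IsMedian Γ p₁ p₂ p₃ m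

/-- `a, b, c, d` are, in this cyclic order, the (distinct) vertices of a 4-cycle. -/
def IsFourCycle (Γ : SimpleGraph V) (a b c d : V) : Prop :=
  Γ.Adj a b ∧ Γ.Adj b c ∧ Γ.Adj c d ∧ Γ.Adj d a ∧ a ≠ c ∧ b ≠ d

/-- `o` orients each edge in exactly one direction; `o p q` means that the edge `pq` is oriented
from `q` to `p`. -/
def IsOrientation (Γ : SimpleGraph V) (o : V → V → Prop) : Prop :=
  (∀ p q : V, o p q → Γ.Adj p q) ∧ ∀ p q : V, Γ.Adj p q → (o p q ↔ ¬ o q p)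

/-- An orientation is admissible if for every 4-cycle `uv, vv', v'u', u'u` the edge `uv` is
oriented from `v` to `u` if and only if `u'v'` is oriented from `v'` to `u'`. -/
def IsAdmissible (Γ : SimpleGraph V) (o : V → V → Prop) : Prop :=
  IsOrientation Γ o ∧ ∀ u v v' u' : V, IsFourCycle Γ u v v' u' → (o u v ↔ o u' v')

/-- A graph is orientable if it has an admissible orientation. -/
def IsOrientable (Γ : SimpleGraph V) : Prop :=
  ∃ o : V → V → Prop, IsAdmissible Γ o

/-- `e` and `e'` belong to a common 4-cycle and share no vertex (that is, they are opposite). -/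
def IsOpposite (Γ : SimpleGraph V) (e e' : Γ.edgeSet) : Prop :=
  ∃ u v v' u' : V, IsFourCycle Γ u v v' u' ∧ e.1 = s(u, v) ∧ e'.1 = s(u', v')

/-- `e` and `e'` are joined by a finite sequence of edges in which consecutive edges are opposite
in a 4-cycle. The classes of this relation are the orbits. -/
def IsProjective (Γ : SimpleGraph V) (e e' : Γ.edgeSet) : Prop :=
  Relation.ReflTransGen (IsOpposite Γ) e e'

/-- `h` takes the same value on edges of the same orbit. -/
def IsOrbitInvariant (Γ : SimpleGraph V) (h : Γ.edgeSet → ℝ) : Prop :=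
  ∀ e e' : Γ.edgeSet, IsProjective Γ e e' → h e = h e'

/-- Total length of a walk with respect to the edge-length `h`. -/
def walkLength (Γ : SimpleGraph V) (h : Γ.edgeSet → ℝ) : {p q : V} → Γ.Walk p q → ℝ
  | _, _, .nil => 0
  | _, _, .cons (u := u) (v := v) huv w =>
      h ⟨s(u, v), (SimpleGraph.mem_edgeSet Γ).2 huv⟩ + walkLength Γ h w

/-- The shortest path metric of `Γ` with respect to the edge-length `h`. -/
noncomputable def weightedDist (Γ : SimpleGraph V) (h : Γ.edgeSet → ℝ) (p q : V) : ℝ :=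
  ⨅ w : Γ.Walk p q, walkLength Γ h w

/-- The multifacility location function. The ground set consists of the vertices of `Γ` and `n`
further elements; `c` is a cost on its pairs (the values on the diagonal of `Sym2` are not
used). -/
noncomputable def locationCost [Fintype V] (Γ : SimpleGraph V) (h : Γ.edgeSet → ℝ) {n : ℕ}
    (c : Sym2 (V ⊕ Fin n) → ℚ) (ρ : Fin n → V) : ℝ :=
  (∑ s : V, ∑ j : Fin n, (c s(Sum.inl s, Sum.inr j) : ℝ) * weightedDist Γ h s (ρ j)) +
  ∑ i : Fin n, ∑ j ∈ Finset.Ioi i,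
    (c s(Sum.inr i, Sum.inr j) : ℝ) * weightedDist Γ h (ρ i) (ρ j)

/-- `ρ` minimizes the multifacility location function over all locations. -/
def IsOptimalLocation [Fintype V] (Γ : SimpleGraph V) (h : Γ.edgeSet → ℝ) {n : ℕ}
    (c : Sym2 (V ⊕ Fin n) → ℚ) (ρ : Fin n → V) : Prop :=
  ∀ ρ' : Fin n → V, locationCost Γ h c ρ ≤ locationCost Γ h c ρ'

end ModularGraph

/-! Orbit-invariant lengths add along shortest paths of `Γ`: opposite edges of a 4-cycle have equal
length and modularity supplies the 4-cycles, so `d_{Γ,h}` is the sum of `h` along any `Γ`-geodesic.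
The location cost is therefore linear in `h` and splits into one part per orbit.

Suppose ρ is optimal for 1 but not for `h`. Among the σ that beat ρ for `h`, the one with the
smallest ratio of loss for 1 to gain for `h` gives `t ≥ 0` such that ρ and σ are both optimal for `t
h + 1`. This length is positive, so it suffices that for a positive orbit-invariant length each
orbit part is constant on the set of minimizers (`IsPositiveMetric.metricCost_eq`).

For that, an admissible orientation is integrated to a height ψ, hence a partial order, and
reversing one orbit gives another height ψ'. Minimizers in a box are linked by chains of minimizers
comparable in the product order, for either height. Among minimizers with different orbit parts,
take a closest pair `p, q` comparable for one of the heights, say ψ. Linking `p` to `q` by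
ψ'-comparable minimizers inside the box `[p, q]` gives `p', q'` with different orbit parts. They
cannot be closer, so `p` and `q` lie between `p'` and `q'`. Then geodesics from `p` to `p'` use only
reversed edges and those from `p'` to `q` only unreversed ones. Equality of the total costs at `p`
and `p'` now forces equality of the orbit parts at `p` and `q`.

The links come from a submodular-type inequality. Upper sets are modular meet-semilattices in which
two elements need not have a join. The join of `a` and `b` is replaced by a family: for θ in (0,1),
maximize `θ φ(x) + (1 - θ) φ(y)` over `x` in `[a ∧ b, a]` and `y` in `[a ∧ b, b]` with a common
upper bound, and put `u_θ = x ∨ y`. The cost at `a ∧ b` plus the average of the costs at `u_θ` is at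
most the sum of the costs at `a` and `b`. It is used for θ = k/N with an error independent of N
before scaling (`IsOrderedModular.metricCost_le`). -/

namespace ModularGraph

/-! ### Medians, quadrangles and sums along shortest paths -/

variable {V : Type*} {Γ : SimpleGraph V}

/-- `c` lies on a shortest path between `a` and `b`. -/
def Btw (Γ : SimpleGraph V) (a c b : V) : Prop :=
  Γ.dist a b = Γ.dist a c + Γ.dist c b

theorem Btw.symm {a c b : V} (h : Btw Γ a c b) : Btw Γ b c a := by
  unfold Btw at *
  rw [Γ.dist_comm (u := b) (v := a), Γ.dist_comm (u := b) (v := c), Γ.dist_comm (u := c) (v := a)]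
  omega

theorem btw_left (a b : V) : Btw Γ a a b := by simp [Btw]

/-- A set of vertices is convex if it contains all shortest paths between its members. -/
def IsGeodesicallyConvex (Γ : SimpleGraph V) (S : Set V) : Prop :=
  ∀ a ∈ S, ∀ b ∈ S, ∀ c, Btw Γ a c b → c ∈ S

/-- Invariance of a function on directed edges under passing to the opposite edge of a 4-cycle. -/
def SquareInvariant (Γ : SimpleGraph V) (f : V → V → ℝ) : Prop :=
  ∀ u v v' u' : V, IsFourCycle Γ u v v' u' → f u v = f u' v'

theorem IsFourCycle.rotate {a b c d : V} (h : IsFourCycle Γ a b c d) : IsFourCycle Γ b c d a :=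
  ⟨h.2.1, h.2.2.1, h.2.2.2.1, h.1, h.2.2.2.2.2, h.2.2.2.2.1.symm⟩

theorem IsFourCycle.reverse {a b c d : V} (h : IsFourCycle Γ a b c d) : IsFourCycle Γ d c b a :=
  ⟨h.2.2.1.symm, h.2.1.symm, h.1.symm, h.2.2.2.1.symm, h.2.2.2.2.2.symm, h.2.2.2.2.1.symm⟩

/-- A connected modular graph. -/
structure IsConnectedModular (Γ : SimpleGraph V) : Prop where
  conn : Γ.Connected
  modular : IsModular Γ

namespace IsConnectedModular

theorem triangle (hΓ : IsConnectedModular Γ) (a b c : V) :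
    Γ.dist a c ≤ Γ.dist a b + Γ.dist b c :=
  hΓ.conn.dist_triangle

theorem eq_of_dist (hΓ : IsConnectedModular Γ) {a b : V} (h : Γ.dist a b = 0) : a = b :=
  hΓ.conn.dist_eq_zero_iff.1 h

theorem median (hΓ : IsConnectedModular Γ) (a b c : V) :
    ∃ m, Btw Γ a m b ∧ Btw Γ b m c ∧ Btw Γ a m c := by
  obtain ⟨m, h1, h2, h3⟩ := hΓ.modular a b c
  exact ⟨m, h1, h2, h3⟩

/-- A median of `u, v, w` lies on the edge `uv`, so it is `u` or `v`. This is bipartiteness. -/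
theorem dist_adj (hΓ : IsConnectedModular Γ) {u v : V} (h : Γ.Adj u v) (w : V) :
    Γ.dist w u = Γ.dist w v + 1 ∨ Γ.dist w v = Γ.dist w u + 1 := by
  obtain ⟨m, h1, h2, h3⟩ := hΓ.median u v w
  have huv : Γ.dist u v = 1 := SimpleGraph.dist_eq_one_iff_adj.2 h
  have e1 := Γ.dist_comm (u := w) (v := u)
  have e2 := Γ.dist_comm (u := w) (v := v)
  have e3 := Γ.dist_comm (u := v) (v := m)
  unfold Btw at *
  rcases Nat.eq_zero_or_pos (Γ.dist u m) with h0 | h0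
  · have := hΓ.eq_of_dist h0
    subst this
    omega
  · have h4 : Γ.dist m v = 0 := by omega
    have := hΓ.eq_of_dist h4
    subst this
    omega

theorem exists_neighbor (hΓ : IsConnectedModular Γ) {u z : V} (h : u ≠ z) :
    ∃ v, Γ.Adj u v ∧ Γ.dist u z = Γ.dist v z + 1 := by
  obtain ⟨p, hp⟩ := hΓ.conn.exists_walk_length_eq_dist u z
  cases p with
  | nil => exact absurd rfl h
  | cons huv q =>
    rename_i v
    refine ⟨v, huv, ?_⟩
    have h1 := Γ.dist_le q
    have h2 := hΓ.triangle u v z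
    have h3 : Γ.dist u v = 1 := SimpleGraph.dist_eq_one_iff_adj.2 huv
    simp only [SimpleGraph.Walk.length_cons] at hp
    omega

theorem btw_trans_left (hΓ : IsConnectedModular Γ) {a b c d : V} (h1 : Btw Γ a c b)
    (h2 : Btw Γ a d c) : Btw Γ a d b ∧ Btw Γ d c b := by
  have h3 := hΓ.triangle a d b
  have h4 := hΓ.triangle d c b
  unfold Btw at *
  omega

theorem btw_trans_right (hΓ : IsConnectedModular Γ) {a b c d : V} (h1 : Btw Γ a c b)
    (h2 : Btw Γ c d b) : Btw Γ a d b ∧ Btw Γ a c d := by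
  have h3 := hΓ.triangle a d b
  have h4 := hΓ.triangle a c d
  unfold Btw at *
  omega

theorem btw_of_adj {u v z : V} (h : Γ.Adj u v) (hd : Γ.dist u z = Γ.dist v z + 1) :
    Btw Γ u v z := by
  have h3 : Γ.dist u v = 1 := SimpleGraph.dist_eq_one_iff_adj.2 h
  unfold Btw
  omega

/-- Bipartiteness puts `v` and `w` at distance 2; a median of `u, v, w` is then their common
neighbour one step nearer to `u`. -/
theorem quadrangle (hΓ : IsConnectedModular Γ) {u v w z : V} (hvz : Γ.Adj v z) (hwz : Γ.Adj w z)
    (hvw : v ≠ w) (hv : Γ.dist u z = Γ.dist u v + 1) (hw : Γ.dist u z = Γ.dist u w + 1) :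
    ∃ x, Γ.Adj x v ∧ Γ.Adj x w ∧ Γ.dist u v = Γ.dist u x + 1 ∧ IsFourCycle Γ x v z w := by
  have h2 : Γ.dist v w = 2 := by
    have h1 := hΓ.triangle v z w
    have h3 : Γ.dist v z = 1 := SimpleGraph.dist_eq_one_iff_adj.2 hvz
    have h4 : Γ.dist z w = 1 := SimpleGraph.dist_eq_one_iff_adj.2 hwz.symm
    have h5 : Γ.dist v w ≠ 0 := fun h => hvw (hΓ.eq_of_dist h)
    have h6 : Γ.dist v w ≠ 1 := fun h => by
      have h7 := hΓ.dist_adj (SimpleGraph.dist_eq_one_iff_adj.1 h) u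
      omega
    omega
  obtain ⟨x, hx1, hx2, hx3⟩ := hΓ.median u v w
  have e := Γ.dist_comm (u := v) (v := x)
  unfold Btw at hx1 hx2 hx3
  have a1 : Γ.Adj x v := SimpleGraph.dist_eq_one_iff_adj.1 (by omega)
  have a2 : Γ.Adj x w := SimpleGraph.dist_eq_one_iff_adj.1 (by omega)
  have hxz : x ≠ z := by
    rintro rfl
    omega
  exact ⟨x, a1, a2, by omega, a1, hvz, hwz.symm, a2.symm, hxz, hvw⟩

/-- A square-invariant function on directed edges sums consistently along shortest paths. -/
theorem exists_geodesicSum (hΓ : IsConnectedModular Γ) {f : V → V → ℝ}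
    (hf : SquareInvariant Γ f) (u : V) :
    ∃ H : V → ℝ, H u = 0 ∧
      ∀ v z, Γ.Adj v z → Γ.dist u z = Γ.dist u v + 1 → H z = H v + f v z := by
  classical
  -- Level by level from `u`, through an arbitrarily chosen predecessor. The default 0 is never met
  -- at a vertex of the right level.
  let A : ℕ → V → ℝ := fun n => Nat.rec (fun _ => 0) (fun n ih z =>
    if h : ∃ v, Γ.Adj v z ∧ Γ.dist u v = n then ih h.choose + f h.choose z else 0) n
  have key : ∀ n v z, Γ.Adj v z → Γ.dist u v = n → Γ.dist u z = n + 1 →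
      A (n + 1) z = A n v + f v z := by
    intro n
    induction n with
    | zero =>
      intro v z hvz hv hz
      have hex : ∃ v, Γ.Adj v z ∧ Γ.dist u v = 0 := ⟨v, hvz, hv⟩
      have h1 : A 1 z = A 0 hex.choose + f hex.choose z := dif_pos hex
      have h2 : hex.choose = v :=
        (hΓ.eq_of_dist hex.choose_spec.2).symm.trans (hΓ.eq_of_dist hv)
      rw [zero_add, h1, h2]
    | succ n ih =>
      intro v z hvz hv hz
      have hex : ∃ v, Γ.Adj v z ∧ Γ.dist u v = n + 1 := ⟨v, hvz, hv⟩
      have h1 : A (n + 1 + 1) z = A (n + 1) hex.choose + f hex.choose z := dif_pos hex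
      obtain ⟨hwz, hw⟩ := hex.choose_spec
      rw [h1]
      generalize hex.choose = w at hwz hw ⊢
      by_cases hvw : v = w
      · rw [hvw]
      -- Two predecessors `v, w` of `z` close up to a 4-cycle with `x` two levels below `z`.
      -- Invariance makes the two routes from `x` to `z` have equal sums.
      · obtain ⟨x, hxv, hxw, hx, hc⟩ :=
          hΓ.quadrangle (u := u) hvz hwz hvw (by omega) (by omega)
        rw [ih x v hxv (by omega) hv, ih x w hxw (by omega) hw]
        have e1 := hf _ _ _ _ hc
        have e2 := hf _ _ _ _ hc.reverse.rotate.rotate.rotate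
        linarith
  refine ⟨fun z => A (Γ.dist u z) z, by simp [A], fun v z hvz hd => ?_⟩
  have := key (Γ.dist u v) v z hvz rfl hd
  simpa only [hd] using this

end IsConnectedModular

/-! ### Metrics that are additive on shortest paths -/

/-- `δ` is the metric that sums the symmetric edge weight `g` along shortest paths. -/
structure IsGeodesicMetric (Γ : SimpleGraph V) (g δ : V → V → ℝ) : Prop where
  self : ∀ u, δ u u = 0
  symm : ∀ u v, δ u v = δ v u
  triangle : ∀ u v w, δ u w ≤ δ u v + δ v w
  btw : ∀ a c b, Btw Γ a c b → δ a b = δ a c + δ c b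
  adj : ∀ u v, Γ.Adj u v → δ u v = g u v

theorem IsGeodesicMetric.nonneg {g δ : V → V → ℝ} (h : IsGeodesicMetric Γ g δ) (u v : V) :
    0 ≤ δ u v := by
  have h1 := h.triangle u v u
  rw [h.self, h.symm v u] at h1
  linarith

/-- Adding the last edge of a shortest path already determines everything: the recursion yields
additivity, additivity yields symmetry by reversing paths, and bipartiteness gives the triangle
inequality one edge at a time. -/
theorem IsConnectedModular.isGeodesicMetric_of_rec (hΓ : IsConnectedModular Γ) {g δ : V → V → ℝ}
    (hsymm : ∀ u v, g u v = g v u) (hnn : ∀ u v, Γ.Adj u v → 0 ≤ g u v) (hself : ∀ u, δ u u = 0)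
    (hrec : ∀ u v z, Γ.Adj v z → Γ.dist u z = Γ.dist u v + 1 → δ u z = δ u v + g v z) :
    IsGeodesicMetric Γ g δ := by
  have hadj : ∀ u v, Γ.Adj u v → δ u v = g u v := by
    intro u v huv
    rw [hrec u u v huv (by simp [SimpleGraph.dist_eq_one_iff_adj.2 huv]), hself, zero_add]
  have hbtw : ∀ n a c b, Γ.dist c b = n → Btw Γ a c b → δ a b = δ a c + δ c b := by
    intro n
    induction n with
    | zero =>
      intro a c b hn _
      rw [hΓ.eq_of_dist hn, hself, add_zero]
    | succ n ih =>
      intro a c b hn h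
      have hne : b ≠ c := by
        rintro rfl
        simp at hn
      obtain ⟨v, hbv, hd⟩ := hΓ.exists_neighbor hne
      have e1 := Γ.dist_comm (u := b) (v := c)
      have e2 := Γ.dist_comm (u := v) (v := c)
      have h3 : Btw Γ c v b := (IsConnectedModular.btw_of_adj hbv hd).symm
      obtain ⟨h4, h5⟩ := hΓ.btw_trans_right h h3
      have e3 : Γ.dist v b = 1 := SimpleGraph.dist_eq_one_iff_adj.2 hbv.symm
      rw [hrec a v b hbv.symm (by unfold Btw at h4; omega), hrec c v b hbv.symm (by omega),
        ih a c v (by omega) h5]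
      ring
  have hsym : ∀ n a b, Γ.dist a b = n → δ a b = δ b a := by
    intro n
    induction n with
    | zero =>
      intro a b hn
      rw [hΓ.eq_of_dist hn]
    | succ n ih =>
      intro a b hn
      have hne : a ≠ b := by
        rintro rfl
        simp at hn
      obtain ⟨v, hav, hd⟩ := hΓ.exists_neighbor hne
      have h3 := IsConnectedModular.btw_of_adj hav hd
      rw [hbtw _ a v b rfl h3, hbtw _ b v a rfl h3.symm, ih v b (by omega), hadj _ _ hav,
        hadj _ _ hav.symm, hsymm]
      ring
  have hnonneg : ∀ n a b, Γ.dist a b = n → 0 ≤ δ a b := by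
    intro n
    induction n with
    | zero =>
      intro a b hn
      rw [hΓ.eq_of_dist hn, hself]
    | succ n ih =>
      intro a b hn
      have hne : a ≠ b := by
        rintro rfl
        simp at hn
      obtain ⟨v, hav, hd⟩ := hΓ.exists_neighbor hne
      rw [hbtw _ a v b rfl (IsConnectedModular.btw_of_adj hav hd), hadj _ _ hav]
      exact add_nonneg (hnn _ _ hav) (ih v b (by omega))
  have htri1 : ∀ u v w, Γ.Adj v w → δ u w ≤ δ u v + g v w := by
    intro u v w hvw
    rcases hΓ.dist_adj hvw u with h | h
    · have := hrec u w v hvw.symm h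
      rw [hsymm] at this
      linarith [hnn _ _ hvw]
    · exact (hrec u v w hvw h).le
  have htri : ∀ n u v w, Γ.dist v w = n → δ u w ≤ δ u v + δ v w := by
    intro n
    induction n with
    | zero =>
      intro u v w hn
      rw [hΓ.eq_of_dist hn, hself, add_zero]
    | succ n ih =>
      intro u v w hn
      have hne : v ≠ w := by
        rintro rfl
        simp at hn
      obtain ⟨x, hvx, hd⟩ := hΓ.exists_neighbor hne
      rw [hbtw _ v x w rfl (IsConnectedModular.btw_of_adj hvx hd), hadj _ _ hvx]
      linarith [htri1 u v x hvx, ih u x w (by omega)]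
  exact ⟨hself, fun u v => hsym _ u v rfl, fun u v w => htri _ u v w rfl,
    fun a c b => hbtw _ a c b rfl, hadj⟩

/-- The edge-length as a function of pairs of vertices, zero on non-adjacent pairs. -/
noncomputable def edgeWeight (Γ : SimpleGraph V) (h : Γ.edgeSet → ℝ) (u v : V) : ℝ :=
  open Classical in
  if huv : Γ.Adj u v then h ⟨s(u, v), (SimpleGraph.mem_edgeSet Γ).2 huv⟩ else 0

theorem edgeWeight_of_adj (h : Γ.edgeSet → ℝ) {u v : V} (huv : Γ.Adj u v) :
    edgeWeight Γ h u v = h ⟨s(u, v), (SimpleGraph.mem_edgeSet Γ).2 huv⟩ :=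
  dif_pos huv

theorem edgeWeight_symm (h : Γ.edgeSet → ℝ) (u v : V) : edgeWeight Γ h u v = edgeWeight Γ h v u := by
  by_cases huv : Γ.Adj u v
  · rw [edgeWeight_of_adj h huv, edgeWeight_of_adj h huv.symm]
    congr 2
    exact Sym2.eq_swap
  · rw [edgeWeight, edgeWeight, dif_neg huv, dif_neg fun h => huv h.symm]

theorem IsOrbitInvariant.squareInvariant {h : Γ.edgeSet → ℝ} (hh : IsOrbitInvariant Γ h) :
    SquareInvariant Γ (edgeWeight Γ h) := by
  intro u v v' u' hc
  rw [edgeWeight_of_adj h hc.1, edgeWeight_of_adj h hc.2.2.1.symm]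
  exact hh _ _ (Relation.ReflTransGen.single ⟨u, v, v', u', hc, rfl, rfl⟩)

/-- The geodesic sum bounds every walk length from below by its triangle inequality, and a shortest
walk of `Γ` attains it. So the weighted distance is this sum. -/
theorem weightedDist_isGeodesicMetric (hΓ : IsConnectedModular Γ) {h : Γ.edgeSet → ℝ}
    (hh : IsOrbitInvariant Γ h) (hnn : ∀ e, 0 ≤ h e) :
    IsGeodesicMetric Γ (edgeWeight Γ h) (weightedDist Γ h) := by
  choose H hH0 hH using hΓ.exists_geodesicSum hh.squareInvariant
  have hnn' : ∀ u v, Γ.Adj u v → 0 ≤ edgeWeight Γ h u v := fun u v huv => by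
    rw [edgeWeight_of_adj h huv]
    exact hnn _
  have hG : IsGeodesicMetric Γ (edgeWeight Γ h) H :=
    hΓ.isGeodesicMetric_of_rec (edgeWeight_symm h) hnn' hH0 hH
  have hlow : ∀ {p q : V} (w : Γ.Walk p q), H p q ≤ walkLength Γ h w := by
    intro p q w
    induction w with
    | nil => simp [walkLength, hG.self]
    | cons huv w ih =>
      rename_i a b c
      have h1 := hG.triangle a b c
      rw [hG.adj _ _ huv, edgeWeight_of_adj h huv] at h1
      simp only [walkLength]
      linarith
  have hex : ∀ n p q, Γ.dist p q = n → ∃ w : Γ.Walk p q, walkLength Γ h w = H p q := by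
    intro n
    induction n with
    | zero =>
      intro p q hn
      obtain rfl := hΓ.eq_of_dist hn
      exact ⟨.nil, by simp [walkLength, hG.self]⟩
    | succ n ih =>
      intro p q hn
      have hne : p ≠ q := by
        rintro rfl
        simp at hn
      obtain ⟨v, hpv, hd⟩ := hΓ.exists_neighbor hne
      obtain ⟨w, hw⟩ := ih v q (by omega)
      refine ⟨.cons hpv w, ?_⟩
      rw [hG.btw p v q (IsConnectedModular.btw_of_adj hpv hd), hG.adj _ _ hpv,
        edgeWeight_of_adj h hpv, ← hw]
      simp [walkLength]
  have heq : weightedDist Γ h = H := by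
    funext p q
    obtain ⟨w, hw⟩ := hex _ p q rfl
    apply le_antisymm
    · rw [← hw]
      exact ciInf_le ⟨H p q, by rintro _ ⟨w, rfl⟩; exact hlow w⟩ w
    · have : Nonempty (Γ.Walk p q) := ⟨w⟩
      exact le_ciInf fun w => hlow w
  rw [heq]
  exact hG

end ModularGraph

namespace ModularGraph

/-! ### Heights and the partial orders they define -/

variable {V : Type*} {Γ : SimpleGraph V}

/-- A height function: it changes by one along each edge, and opposite edges of a 4-cycle
have the same direction. -/
structure IsHeight (Γ : SimpleGraph V) (ψ : V → ℝ) : Prop where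
  adj : ∀ u v, Γ.Adj u v → ψ v = ψ u + 1 ∨ ψ u = ψ v + 1
  square : ∀ u v v' u', IsFourCycle Γ u v v' u' → ψ v - ψ u = ψ v' - ψ u'

theorem IsHeight.neg {ψ : V → ℝ} (h : IsHeight Γ ψ) : IsHeight Γ (-ψ) where
  adj u v huv := by
    rcases h.adj u v huv with h1 | h1
    · right; simp only [Pi.neg_apply]; linarith
    · left; simp only [Pi.neg_apply]; linarith
  square u v v' u' hc := by
    have := h.square u v v' u' hc
    simp only [Pi.neg_apply]; linarith

/-- There is a shortest path from `a` up to `b` along which the height increases at each step. -/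
def Below (Γ : SimpleGraph V) (ψ : V → ℝ) (a b : V) : Prop :=
  ψ b - ψ a = Γ.dist a b

theorem below_neg {ψ : V → ℝ} {a b : V} : Below Γ (-ψ) a b ↔ Below Γ ψ b a := by
  unfold Below
  rw [Γ.dist_comm (u := b)]
  simp only [Pi.neg_apply]
  constructor <;> intro h <;> linarith

theorem below_refl (ψ : V → ℝ) (a : V) : Below Γ ψ a a := by simp [Below]

namespace IsConnectedModular

theorem triangle_real (hΓ : IsConnectedModular Γ) (a b c : V) :
    (Γ.dist a c : ℝ) ≤ Γ.dist a b + Γ.dist b c := by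
  exact_mod_cast hΓ.triangle a b c

/-- Integrate from a base vertex: every edge goes one level up or down, and antisymmetry handles the
second case. -/
theorem exists_potential (hΓ : IsConnectedModular Γ) {f : V → V → ℝ} (hf : SquareInvariant Γ f)
    (hanti : ∀ u v, Γ.Adj u v → f u v = - f v u) :
    ∃ φ : V → ℝ, ∀ u v, Γ.Adj u v → φ v - φ u = f u v := by
  obtain ⟨o⟩ := hΓ.conn.nonempty
  obtain ⟨H, -, hH⟩ := hΓ.exists_geodesicSum hf o
  refine ⟨H, fun u v huv => ?_⟩
  rcases hΓ.dist_adj huv o with h | h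
  · rw [hH v u huv.symm h, hanti u v huv]
    ring
  · rw [hH u v huv h]
    ring

end IsConnectedModular

namespace IsHeight

variable {ψ : V → ℝ}

theorem sub_le_dist (hψ : IsHeight Γ ψ) (hΓ : IsConnectedModular Γ) (a b : V) :
    ψ b - ψ a ≤ Γ.dist a b := by
  induction hn : Γ.dist a b generalizing a with
  | zero =>
    obtain rfl := hΓ.eq_of_dist hn
    simp
  | succ n ih =>
    have hne : a ≠ b := by
      rintro rfl
      simp at hn
    obtain ⟨v, hav, hd⟩ := hΓ.exists_neighbor hne
    have h1 := ih v (by omega)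
    push_cast
    rcases hψ.adj a v hav with h | h <;> linarith

theorem below_trans (hψ : IsHeight Γ ψ) (hΓ : IsConnectedModular Γ) {a b c : V}
    (h1 : Below Γ ψ a b) (h2 : Below Γ ψ b c) : Below Γ ψ a c ∧ Btw Γ a b c := by
  have h3 := hψ.sub_le_dist hΓ a c
  have h4 := hΓ.triangle_real a b c
  unfold Below at *
  have h5 : (Γ.dist a c : ℝ) = Γ.dist a b + Γ.dist b c := by linarith
  exact ⟨by linarith, by exact_mod_cast h5⟩

theorem below_of_btw (hψ : IsHeight Γ ψ) (hΓ : IsConnectedModular Γ) {a b c : V}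
    (h : Below Γ ψ a b) (hc : Btw Γ a c b) : Below Γ ψ a c ∧ Below Γ ψ c b := by
  have h1 := hψ.sub_le_dist hΓ a c
  have h2 := hψ.sub_le_dist hΓ c b
  have h3 : (Γ.dist a b : ℝ) = Γ.dist a c + Γ.dist c b := by exact_mod_cast hc
  unfold Below at *
  constructor <;> linarith

theorem below_antisymm (hΓ : IsConnectedModular Γ) {a b : V} (h1 : Below Γ ψ a b)
    (h2 : Below Γ ψ b a) : a = b := by
  unfold Below at *
  rw [Γ.dist_comm (u := b)] at h2
  have h3 : (Γ.dist a b : ℝ) = 0 := by linarith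
  exact hΓ.eq_of_dist (by exact_mod_cast h3)

theorem below_of_adj {a b : V} (h : Γ.Adj a b) (hab : ψ b = ψ a + 1) :
    Below Γ ψ a b := by
  unfold Below
  rw [SimpleGraph.dist_eq_one_iff_adj.2 h, hab]
  simp

theorem below_or_of_adj (hψ : IsHeight Γ ψ) {a b : V} (h : Γ.Adj a b) :
    Below Γ ψ a b ∨ Below Γ ψ b a := by
  rcases hψ.adj a b h with h1 | h1
  · exact Or.inl (below_of_adj h h1)
  · exact Or.inr (below_of_adj h.symm h1)

theorem adj_height {a b : V} (h : Γ.Adj a b)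
    (hb : Below Γ ψ a b) : ψ b = ψ a + 1 := by
  unfold Below at hb
  rw [SimpleGraph.dist_eq_one_iff_adj.2 h] at hb
  push_cast at hb
  linarith

/-- It is enough that the first step `c` of a geodesic from `a` to `b` stays above `m`. Only a
downward step is in doubt. If `a` is itself a median of `a, b, m`, then `a` is below `b` and the
step stays above `a`. Otherwise step from `a` down to some `a1` toward the median; a quadrangle
gives a vertex `x` nearer to `b` and adjacent to both `a1` and `c`. Induction puts `x` above `m`,
and the square puts `c` above `x`. -/
theorem convex_up (hψ : IsHeight Γ ψ) (hΓ : IsConnectedModular Γ) (m : V) :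
    IsGeodesicallyConvex Γ {x | Below Γ ψ m x} := by
  have key : ∀ n a b, Γ.dist a b = n → Below Γ ψ m a → Below Γ ψ m b → ∀ c, Γ.Adj a c →
      Γ.dist a b = Γ.dist c b + 1 → Below Γ ψ m c := by
    intro n
    induction n with
    | zero =>
      intro a b hn _ _ c _ h
      omega
    | succ n ih =>
      intro a b hn ha hb c hac hd
      rcases hψ.below_or_of_adj hac with hup | hdown
      · exact (hψ.below_trans hΓ ha hup).1
      obtain ⟨μ, hμ1, hμ2, hμ3⟩ := hΓ.median a b m
      have hma : Below Γ ψ m μ ∧ Below Γ ψ μ a := hψ.below_of_btw hΓ ha hμ3.symm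
      by_cases hμ : μ = a
      · subst hμ
        have h1 := (hψ.below_of_btw hΓ hb hμ2.symm).2
        have h2 := (hψ.below_of_btw hΓ h1 (IsConnectedModular.btw_of_adj hac hd)).1
        exact (hψ.below_trans hΓ ha h2).1
      · obtain ⟨a1, haa1, hd1⟩ := hΓ.exists_neighbor (fun h => hμ h.symm : a ≠ μ)
        have hb1 := IsConnectedModular.btw_of_adj haa1 hd1
        have h1 : Below Γ ψ μ a1 ∧ Below Γ ψ a1 a := hψ.below_of_btw hΓ hma.2 hb1.symm
        have hma1 := (hψ.below_trans hΓ hma.1 h1.1).1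
        by_cases hca : c = a1
        · rw [hca]
          exact hma1
        have hb2 := (hΓ.btw_trans_left hμ1 hb1).1
        have hd2 : Γ.dist a a1 = 1 := SimpleGraph.dist_eq_one_iff_adj.2 haa1
        unfold Btw at hb2
        have e1 := Γ.dist_comm (u := b) (v := a)
        have e2 := Γ.dist_comm (u := b) (v := c)
        have e3 := Γ.dist_comm (u := b) (v := a1)
        obtain ⟨x, hxc, hxa1, hx, hcyc⟩ := hΓ.quadrangle (u := b) hac.symm haa1.symm hca
          (by omega) (by omega)
        have e4 := Γ.dist_comm (u := b) (v := x)
        have hmx : Below Γ ψ m x :=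
          ih a1 b (by omega) hma1 hb x hxa1.symm (by omega)
        have hsq := hψ.square _ _ _ _ hcyc
        have h3 := adj_height hac.symm hdown
        have h4 := adj_height haa1.symm h1.2
        have hxc' : Below Γ ψ x c := by
          refine below_of_adj hxc ?_
          linarith
        exact (hψ.below_trans hΓ hmx hxc').1
  have main : ∀ n a b, Γ.dist a b = n → Below Γ ψ m a → Below Γ ψ m b → ∀ c, Btw Γ a c b →
      Below Γ ψ m c := by
    intro n
    induction n with
    | zero =>
      intro a b hn ha hb c hc
      unfold Btw at hc
      have h0 : Γ.dist a c = 0 := by omega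
      rwa [← hΓ.eq_of_dist h0]
    | succ n ih =>
      intro a b hn ha hb c hc
      by_cases hac : a = c
      · rwa [← hac]
      obtain ⟨v, hav, hd⟩ := hΓ.exists_neighbor hac
      obtain ⟨h1, h2⟩ := hΓ.btw_trans_left hc (IsConnectedModular.btw_of_adj hav hd)
      have hd1 : Γ.dist a v = 1 := SimpleGraph.dist_eq_one_iff_adj.2 hav
      unfold Btw at h1
      exact ih v b (by omega) (key _ a b rfl ha hb v hav (by omega)) hb c h2
  exact fun a ha b hb c hc => main _ a b rfl ha hb c hc

theorem convex_down (hψ : IsHeight Γ ψ) (hΓ : IsConnectedModular Γ) (m : V) :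
    IsGeodesicallyConvex Γ {x | Below Γ ψ x m} := by
  intro a ha b hb c hc
  exact below_neg.1 (hψ.neg.convex_up hΓ m a (below_neg.2 ha) b (below_neg.2 hb) c hc)

theorem convex_Icc (hψ : IsHeight Γ ψ) (hΓ : IsConnectedModular Γ) (p q : V) :
    IsGeodesicallyConvex Γ {x | Below Γ ψ p x ∧ Below Γ ψ x q} :=
  fun a ha b hb c hc =>
    ⟨hψ.convex_up hΓ p a ha.1 b hb.1 c hc, hψ.convex_down hΓ q a ha.2 b hb.2 c hc⟩

/-- The partial order of a height function. -/
abbrev toPartialOrder (hψ : IsHeight Γ ψ) (hΓ : IsConnectedModular Γ) : PartialOrder V where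
  le := Below Γ ψ
  le_refl := below_refl ψ
  le_trans _ _ _ h1 h2 := (hψ.below_trans hΓ h1 h2).1
  le_antisymm _ _ h1 h2 := below_antisymm hΓ h1 h2

/-- A common lower bound on a shortest path is the greatest one. -/
theorem below_of_btw_of_below (hψ : IsHeight Γ ψ) (hΓ : IsConnectedModular Γ) {a b w c : V}
    (hw : Btw Γ a w b) (ha : Below Γ ψ c a) (hb : Below Γ ψ c b) : Below Γ ψ c w :=
  hψ.convex_up hΓ c a ha b hb w hw

theorem exists_btw_below (hψ : IsHeight Γ ψ) (hΓ : IsConnectedModular Γ) {a b c : V}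
    (ha : Below Γ ψ c a) (hb : Below Γ ψ c b) :
    ∃ w, Btw Γ a w b ∧ Below Γ ψ w a ∧ Below Γ ψ w b := by
  obtain ⟨w, h1, h2, h3⟩ := hΓ.median a b c
  exact ⟨w, h1, (hψ.below_of_btw hΓ ha h3.symm).2, (hψ.below_of_btw hΓ hb h2.symm).2⟩

end IsHeight

/-- Admissibility says that the function ±1 recording the orientation is square-invariant, so it
integrates. -/
theorem exists_height (hΓ : IsConnectedModular Γ) (ho : IsOrientable Γ) :
    ∃ ψ : V → ℝ, IsHeight Γ ψ := by
  classical
  obtain ⟨o, ho1, ho2⟩ := ho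
  let f : V → V → ℝ := fun u v => if o v u then 1 else -1
  have hf : SquareInvariant Γ f := by
    intro u v v' u' hc
    have h1 := ho2 _ _ _ _ hc
    have h2 := ho1.2 _ _ hc.1
    have h3 := ho1.2 _ _ hc.2.2.1.symm
    have h4 : o v u ↔ o v' u' := by tauto
    simp only [f, h4]
  have hanti : ∀ u v, Γ.Adj u v → f u v = - f v u := by
    intro u v huv
    have h1 := ho1.2 _ _ huv
    by_cases h : o u v
    · simp [f, h, h1.1 h]
    · have : o v u := by tauto
      simp [f, h, this]
  obtain ⟨φ, hφ⟩ := hΓ.exists_potential hf hanti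
  refine ⟨φ, fun u v huv => ?_, fun u v v' u' hc => ?_⟩
  · have := hφ u v huv
    by_cases h : o v u
    · left
      simp only [f, h, if_true] at this
      linarith
    · right
      simp only [f, h, if_false] at this
      linarith
  · rw [hφ _ _ hc.1, hφ _ _ hc.2.2.1.symm]
    exact hf _ _ _ _ hc

/-- `φ` is the height with the edges weighted by `g`. -/
def IsWeightedHeight (Γ : SimpleGraph V) (g : V → V → ℝ) (ψ φ : V → ℝ) : Prop :=
  ∀ u v, Γ.Adj u v → φ v - φ u = g u v * (ψ v - ψ u)

theorem IsHeight.exists_weightedHeight {ψ : V → ℝ} (hψ : IsHeight Γ ψ)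
    (hΓ : IsConnectedModular Γ) {g : V → V → ℝ} (hg : SquareInvariant Γ g)
    (hsymm : ∀ u v, g u v = g v u) : ∃ φ, IsWeightedHeight Γ g ψ φ := by
  refine hΓ.exists_potential (f := fun u v => g u v * (ψ v - ψ u)) ?_ ?_
  · intro u v v' u' hc
    simp only
    rw [hg _ _ _ _ hc, hψ.square _ _ _ _ hc]
  · intro u v _
    rw [hsymm]
    ring

theorem IsWeightedHeight.sub_eq {g δ : V → V → ℝ} {ψ φ : V → ℝ} (h : IsWeightedHeight Γ g ψ φ)
    (hψ : IsHeight Γ ψ) (hΓ : IsConnectedModular Γ) (hδ : IsGeodesicMetric Γ g δ) {a b : V}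
    (hab : Below Γ ψ a b) : δ a b = φ b - φ a := by
  induction hn : Γ.dist a b generalizing a with
  | zero =>
    obtain rfl := hΓ.eq_of_dist hn
    simp [hδ.self]
  | succ n ih =>
    have hne : a ≠ b := by
      rintro rfl
      simp at hn
    obtain ⟨v, hav, hd⟩ := hΓ.exists_neighbor hne
    have hb := IsConnectedModular.btw_of_adj hav hd
    obtain ⟨h1, h2⟩ := hψ.below_of_btw hΓ hab hb
    have h3 := h a v hav
    rw [IsHeight.adj_height hav h1] at h3
    rw [hδ.btw _ _ _ hb, ih h2 (by omega), hδ.adj _ _ hav]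
    linarith

end ModularGraph

namespace ModularGraph

/-! ### Gates of convex sets and translation between them -/

variable {V : Type*} {Γ : SimpleGraph V}

/-- The gate is a nearest point `c`: a median of `z, c, f` lies in `S` by convexity and on a
geodesic from `z` to `c`, so it equals `c`. -/
theorem IsConnectedModular.exists_gate (hΓ : IsConnectedModular Γ) {S : Set V}
    (hS : IsGeodesicallyConvex Γ S) (hne : S.Nonempty) (z : V) :
    ∃ c ∈ S, ∀ f ∈ S, Btw Γ z c f := by
  obtain ⟨c, hc, hmin⟩ :=
    WellFounded.has_min (measure fun x => Γ.dist z x).wf S hne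
  refine ⟨c, hc, fun f hf => ?_⟩
  obtain ⟨m, h1, h2, h3⟩ := hΓ.median z c f
  have hm := hS c hc f hf m h2
  have h4 : ¬ Γ.dist z m < Γ.dist z c := hmin m hm
  unfold Btw at h1
  have h5 : Γ.dist m c = 0 := by omega
  rwa [hΓ.eq_of_dist h5] at h3

/-- `c` and `c'` are each other's gates in the convex sets `S` and `S'`. -/
structure MutualGates (Γ : SimpleGraph V) (S S' : Set V) (c c' : V) : Prop where
  mem : c ∈ S
  mem' : c' ∈ S'
  gate : ∀ f ∈ S, Btw Γ c' c f
  gate' : ∀ f ∈ S', Btw Γ c c' f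

theorem MutualGates.symm {S S' : Set V} {c c' : V} (h : MutualGates Γ S S' c c') :
    MutualGates Γ S' S c' c :=
  ⟨h.mem', h.mem, h.gate', h.gate⟩

/-- Gate `z` into `S`, then the result back into `S'`. Since `c'` lies between `z` and `c`, and `c`
between `z` and every point of `S`, the gate of `c'` is again `c`. -/
theorem IsConnectedModular.exists_mutualGates (hΓ : IsConnectedModular Γ) {S S' : Set V}
    (hS : IsGeodesicallyConvex Γ S) (hne : S.Nonempty) (hS' : IsGeodesicallyConvex Γ S') {z : V}
    (hz : z ∈ S') :
    ∃ c c', MutualGates Γ S S' c c' ∧ (∀ f ∈ S, Btw Γ z c f) ∧ Btw Γ z c' c := by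
  obtain ⟨c, hc, hgc⟩ := hΓ.exists_gate hS hne z
  obtain ⟨c', hc', hgc'⟩ := hΓ.exists_gate hS' ⟨z, hz⟩ c
  have h1 := (hgc' z hz).symm
  refine ⟨c, c', ⟨hc, hc', fun f hf => ?_, hgc'⟩, hgc, h1⟩
  have h2 := hgc f hf
  have h3 := hΓ.triangle z c' f
  have h4 := hΓ.triangle c' c f
  unfold Btw at *
  omega

namespace MutualGates

variable {S S' : Set V} {a a' b b' : V}

theorem dist_eq (ha : MutualGates Γ S S' a a') (hb : MutualGates Γ S S' b b') :
    Γ.dist a' b' = Γ.dist a b ∧ Γ.dist b b' = Γ.dist a a' := by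
  have h1 := ha.gate b hb.mem
  have h2 := ha.gate' b' hb.mem'
  have h3 := hb.gate a ha.mem
  have h4 := hb.gate' a' ha.mem'
  unfold Btw at *
  have e1 := Γ.dist_comm (u := a') (v := b)
  have e2 := Γ.dist_comm (u := b') (v := a)
  have e3 := Γ.dist_comm (u := a') (v := a)
  have e4 := Γ.dist_comm (u := b') (v := b)
  have e5 := Γ.dist_comm (u := b) (v := a)
  have e6 := Γ.dist_comm (u := b') (v := a')
  omega

/-- Mutual gates of the ends of an interval translate the whole interval. -/
theorem exists_translate (hΓ : IsConnectedModular Γ) (hS : IsGeodesicallyConvex Γ S)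
    (hS' : IsGeodesicallyConvex Γ S') (ha : MutualGates Γ S S' a a')
    (hb : MutualGates Γ S S' b b') {c : V} (hc : Btw Γ a c b) :
    ∃ c', MutualGates Γ S S' c c' ∧ Btw Γ a' c' b' := by
  obtain ⟨hd1, hd2⟩ := ha.dist_eq hb
  have hcS := hS a ha.mem b hb.mem c hc
  -- This median lies in `S'` at distance at most that of `a` from `a'`. The gate conditions at both
  -- ends forbid a smaller distance for `c'`, so all the inequalities are equalities and `c'` is
  -- between `a'` and `b'`. The same bound for `e` leaves no room between `e` and `c`.
  obtain ⟨x, hx1, hx2, hx3⟩ := hΓ.median c a' b'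
  have hxS := hS' a' ha.mem' b' hb.mem' x hx2
  obtain ⟨c', hc', hg'⟩ := hΓ.exists_gate hS' ⟨a', ha.mem'⟩ c
  obtain ⟨e, he, hge⟩ := hΓ.exists_gate hS ⟨a, ha.mem⟩ c'
  have t1 := hg' x hxS
  have t2 := hΓ.triangle c a a'
  have t3 := hΓ.triangle c b b'
  have t4 := ha.gate' c' hc'
  have t5 := hb.gate' c' hc'
  have t6 := hΓ.triangle a c c'
  have t7 := hΓ.triangle b c c'
  have t8 := hΓ.triangle a' c' b'
  have t9 := ha.gate e he
  have t10 := hb.gate e he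
  have t11 := hΓ.triangle a' c' e
  have t12 := hΓ.triangle b' c' e
  have t13 := hΓ.triangle a e b
  have t14 := hge c hcS
  unfold Btw at *
  have c1 := Γ.dist_comm (u := c) (v := a)
  have c2 := Γ.dist_comm (u := b) (v := c)
  have c3 := Γ.dist_comm (u := x) (v := a')
  have c4 := Γ.dist_comm (u := b') (v := c')
  have c5 := Γ.dist_comm (u := c') (v := c)
  have c6 := Γ.dist_comm (u := a') (v := a)
  have c7 := Γ.dist_comm (u := b') (v := b)
  have c8 := Γ.dist_comm (u := e) (v := b)
  have h0 : Γ.dist e c = 0 := by omega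
  have hec := hΓ.eq_of_dist h0
  subst hec
  refine ⟨c', ⟨he, hc', hge, hg'⟩, ?_⟩
  show Γ.dist a' b' = _
  omega

/-- The edges `ce` and `c'e'` are the ends of a ladder of 4-cycles. Quadrangles seen from `e'` build
its rungs one by one. -/
theorem squareInvariant_eq (hΓ : IsConnectedModular Γ) {f : V → V → ℝ} (hf : SquareInvariant Γ f)
    {n : ℕ} {c e c' e' : V} (hce : Γ.Adj c e) (h1 : Γ.dist c c' = n) (h2 : Γ.dist e e' = n)
    (h3 : Γ.dist c e' = n + 1) (h4 : Γ.dist e c' = n + 1)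
    (h5 : Γ.dist c' e' = 1) : f c e = f c' e' := by
  induction n generalizing c e with
  | zero => rw [hΓ.eq_of_dist h1, hΓ.eq_of_dist h2]
  | succ n ih =>
    have hne : c ≠ c' := by
      rintro rfl
      simp at h1
    obtain ⟨d, hcd, hd⟩ := hΓ.exists_neighbor hne
    have hde : d ≠ e := by
      rintro rfl
      omega
    have t1 := hΓ.triangle c d e'
    have t2 : Γ.dist c d = 1 := SimpleGraph.dist_eq_one_iff_adj.2 hcd
    have t3 := hΓ.triangle d c' e'
    have c1 := Γ.dist_comm (u := e') (v := c)
    have c2 := Γ.dist_comm (u := e') (v := e)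
    have c3 := Γ.dist_comm (u := e') (v := d)
    obtain ⟨x, hxd, hxe, hx, hcyc⟩ := hΓ.quadrangle (u := e') hcd.symm hce.symm hde
      (by omega) (by omega)
    have c4 := Γ.dist_comm (u := e') (v := x)
    have t4 := hΓ.triangle e x c'
    have t5 : Γ.dist e x = 1 := SimpleGraph.dist_eq_one_iff_adj.2 hxe.symm
    have t7 := hΓ.triangle x d c'
    have t8 : Γ.dist x d = 1 := SimpleGraph.dist_eq_one_iff_adj.2 hxd
    rw [hf _ _ _ _ hcyc.rotate.rotate]
    exact ih hxd.symm (by omega) (by omega) (by omega) (by omega)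

/-- Translation between mutual gates preserves square-invariant data along intervals. -/
theorem induction_on_btw (hΓ : IsConnectedModular Γ) (hS : IsGeodesicallyConvex Γ S)
    (hS' : IsGeodesicallyConvex Γ S') {p : V → V → V → V → Prop} (refl : ∀ a a', p a a' a a')
    (step : ∀ a a' v v' b b', MutualGates Γ S S' a a' → MutualGates Γ S S' v v' → Γ.Adj a v →
      (∀ f : V → V → ℝ, SquareInvariant Γ f → f a v = f a' v') → Γ.Adj a' v' →
      p v v' b b' → p a a' b b')
    (ha : MutualGates Γ S S' a a') (hb : MutualGates Γ S S' b b') : p a a' b b' := by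
  induction hn : Γ.dist a b generalizing a a' with
  | zero =>
    have h1 := (ha.dist_eq hb).1
    obtain rfl := hΓ.eq_of_dist hn
    obtain rfl := hΓ.eq_of_dist (h1.trans hn)
    exact refl _ _
  | succ n ih =>
    have hne : a ≠ b := by
      rintro rfl
      simp at hn
    obtain ⟨v, hav, hd⟩ := hΓ.exists_neighbor hne
    obtain ⟨v', hv, -⟩ :=
      exists_translate hΓ hS hS' ha hb (IsConnectedModular.btw_of_adj hav hd)
    obtain ⟨e1, e2⟩ := ha.dist_eq hv
    have e3 : Γ.dist a v = 1 := SimpleGraph.dist_eq_one_iff_adj.2 hav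
    have e4 := ha.gate' v' hv.mem'
    have e5 := ha.gate v hv.mem
    unfold Btw at e4 e5
    have c1 := Γ.dist_comm (u := a') (v := v)
    have c2 := Γ.dist_comm (u := a') (v := a)
    exact step a a' v v' b b' ha hv hav
      (fun f hf => squareInvariant_eq hΓ hf hav rfl e2 (by omega) (by omega) (by omega))
      (SimpleGraph.dist_eq_one_iff_adj.1 (by omega)) (ih hv (by omega))

theorem potential_sub_eq (hΓ : IsConnectedModular Γ) (hS : IsGeodesicallyConvex Γ S)
    (hS' : IsGeodesicallyConvex Γ S') {f : V → V → ℝ} (hf : SquareInvariant Γ f) {φ : V → ℝ}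
    (hφ : ∀ u v, Γ.Adj u v → φ v - φ u = f u v)
    (ha : MutualGates Γ S S' a a') (hb : MutualGates Γ S S' b b') :
    φ b' - φ a' = φ b - φ a := by
  refine induction_on_btw (p := fun a a' b b' => φ b' - φ a' = φ b - φ a) hΓ hS hS'
    (by simp) ?_ ha hb
  intro a a' v v' b b' _ _ hav hfe hav' ih
  have := hfe f hf
  rw [← hφ _ _ hav, ← hφ _ _ hav'] at this
  linarith

/-- For adjacent `a, v` the distance from `a` to `v'` is additive both through `a'` and through `v`;
the parallel edges have the same weight and cancel. -/
theorem metric_eq (hΓ : IsConnectedModular Γ) (hS : IsGeodesicallyConvex Γ S)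
    (hS' : IsGeodesicallyConvex Γ S') {g δ : V → V → ℝ} (hg : SquareInvariant Γ g)
    (hδ : IsGeodesicMetric Γ g δ) (ha : MutualGates Γ S S' a a')
    (hb : MutualGates Γ S S' b b') : δ b b' = δ a a' := by
  refine induction_on_btw (p := fun a a' b b' => δ b b' = δ a a') hΓ hS hS' (by simp) ?_ ha hb
  intro a a' v v' b b' ha hv hav hfe hav' ih
  have h1 := hfe g hg
  have h2 := hδ.btw _ _ _ (ha.gate' v' hv.mem')
  have h3 := hδ.btw _ _ _ (hv.gate a ha.mem).symm
  rw [hδ.adj _ _ hav, h1] at h3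
  rw [hδ.adj _ _ hav'] at h2
  rw [ih]
  linarith

theorem below_iff {ψ : V → ℝ} (hψ : IsHeight Γ ψ) (hΓ : IsConnectedModular Γ)
    (hS : IsGeodesicallyConvex Γ S) (hS' : IsGeodesicallyConvex Γ S')
    (ha : MutualGates Γ S S' a a') (hb : MutualGates Γ S S' b b') :
    Below Γ ψ a' b' ↔ Below Γ ψ a b := by
  unfold Below
  rw [(ha.dist_eq hb).1, potential_sub_eq (f := fun u v => ψ v - ψ u) hΓ hS hS'
    (fun u v v' u' h => hψ.square u v v' u' h) (fun _ _ _ => rfl) ha hb]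

end MutualGates

end ModularGraph

namespace ModularGraph

/-! ### Meets, partial joins and the modular law -/

variable {V : Type*} {Γ : SimpleGraph V}

/-- A connected modular graph, ordered by a height function `ψ`, with a metric `δ` given by
positive square-invariant edge weights `g`, and the corresponding weighted height `φ`. -/
structure IsOrderedModular [PartialOrder V] (Γ : SimpleGraph V) (g δ : V → V → ℝ)
    (ψ φ : V → ℝ) : Prop where
  graph : IsConnectedModular Γ
  height : IsHeight Γ ψ
  square : SquareInvariant Γ g
  pos : ∀ u v, Γ.Adj u v → 0 < g u v
  metric : IsGeodesicMetric Γ g δ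
  weighted : IsWeightedHeight Γ g ψ φ
  le_iff : ∀ a b : V, a ≤ b ↔ Below Γ ψ a b

namespace IsOrderedModular

variable [PartialOrder V] {g δ : V → V → ℝ} {ψ φ : V → ℝ}

theorem delta_eq (M : IsOrderedModular Γ g δ ψ φ) {a b : V} (h : a ≤ b) : δ a b = φ b - φ a :=
  M.weighted.sub_eq M.height M.graph M.metric ((M.le_iff _ _).1 h)

theorem delta_pos (M : IsOrderedModular Γ g δ ψ φ) {a b : V} (h : a ≠ b) : 0 < δ a b := by
  obtain ⟨v, hav, hd⟩ := M.graph.exists_neighbor h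
  rw [M.metric.btw _ _ _ (IsConnectedModular.btw_of_adj hav hd), M.metric.adj _ _ hav]
  linarith [M.pos _ _ hav, M.metric.nonneg v b]

theorem strictMono (M : IsOrderedModular Γ g δ ψ φ) : StrictMono φ := by
  intro a b h
  have h1 := M.delta_eq h.le
  have h2 := M.delta_pos h.ne
  linarith

theorem monotone (M : IsOrderedModular Γ g δ ψ φ) {a b : V} (h : a ≤ b) : φ a ≤ φ b :=
  M.strictMono.monotone h

theorem eq_of_le (M : IsOrderedModular Γ g δ ψ φ) {a b : V} (h : a ≤ b) (h' : φ b ≤ φ a) :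
    a = b := by
  by_contra hne
  exact absurd (M.strictMono (lt_of_le_of_ne h hne)) (not_lt.2 h')

theorem btw_of_le (M : IsOrderedModular Γ g δ ψ φ) {a b c : V} (h : a ≤ b) (h' : b ≤ c) :
    Btw Γ a b c :=
  (M.height.below_trans M.graph ((M.le_iff _ _).1 h) ((M.le_iff _ _).1 h')).2

/-- Every common lower bound has a convex upper set containing `a` and `b`, hence everything between
them. -/
theorem isGLB_of_btw (M : IsOrderedModular Γ g δ ψ φ) {a b w : V} (h : Btw Γ a w b)
    (ha : w ≤ a) (hb : w ≤ b) : IsGLB {a, b} w := by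
  refine ⟨by rintro _ (rfl | rfl) <;> assumption, fun c hc => ?_⟩
  rw [M.le_iff]
  exact M.height.below_of_btw_of_below M.graph h
    ((M.le_iff _ _).1 (hc (by simp))) ((M.le_iff _ _).1 (hc (by simp)))

theorem isLUB_of_btw (M : IsOrderedModular Γ g δ ψ φ) {a b u : V} (h : Btw Γ a u b)
    (ha : a ≤ u) (hb : b ≤ u) : IsLUB {a, b} u := by
  refine ⟨by rintro _ (rfl | rfl) <;> assumption, fun c hc => ?_⟩
  rw [M.le_iff]
  exact M.height.convex_down M.graph c a ((M.le_iff _ _).1 (hc (by simp))) b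
    ((M.le_iff _ _).1 (hc (by simp))) u h

theorem exists_isGLB (M : IsOrderedModular Γ g δ ψ φ) {a b c : V} (ha : c ≤ a) (hb : c ≤ b) :
    ∃ w, IsGLB {a, b} w ∧ Btw Γ a w b := by
  obtain ⟨w, h1, h2, h3⟩ := M.height.exists_btw_below M.graph
    ((M.le_iff _ _).1 ha) ((M.le_iff _ _).1 hb)
  exact ⟨w, M.isGLB_of_btw h1 ((M.le_iff _ _).2 h2) ((M.le_iff _ _).2 h3), h1⟩

theorem exists_isLUB (M : IsOrderedModular Γ g δ ψ φ) {a b c : V} (ha : a ≤ c) (hb : b ≤ c) :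
    ∃ u, IsLUB {a, b} u ∧ Btw Γ a u b := by
  obtain ⟨w, h1, h2, h3⟩ := M.height.neg.exists_btw_below M.graph
    (below_neg.2 ((M.le_iff _ _).1 ha)) (below_neg.2 ((M.le_iff _ _).1 hb))
  exact ⟨w, M.isLUB_of_btw h1 ((M.le_iff _ _).2 (below_neg.1 h2))
    ((M.le_iff _ _).2 (below_neg.1 h3)), h1⟩

theorem btw_of_isGLB (M : IsOrderedModular Γ g δ ψ φ) {a b w : V} (h : IsGLB {a, b} w) :
    Btw Γ a w b := by
  obtain ⟨w', h1, h2⟩ := M.exists_isGLB (h.1 (by simp : a ∈ _)) (h.1 (by simp : b ∈ _))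
  rwa [h.unique h1]

theorem btw_of_isLUB (M : IsOrderedModular Γ g δ ψ φ) {a b u : V} (h : IsLUB {a, b} u) :
    Btw Γ a u b := by
  obtain ⟨u', h1, h2⟩ := M.exists_isLUB (h.1 (by simp : a ∈ _)) (h.1 (by simp : b ∈ _))
  rwa [h.unique h1]

/-- Three elements bounded in pairs are bounded: each one has two of `p, q, r` above it, so by
convexity it is below their median. -/
theorem exists_upperBound (M : IsOrderedModular Γ g δ ψ φ) {x y z p q r : V} (hxp : x ≤ p)
    (hyp : y ≤ p) (hyq : y ≤ q) (hzq : z ≤ q) (hxr : x ≤ r) (hzr : z ≤ r) :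
    ∃ u, x ≤ u ∧ y ≤ u ∧ z ≤ u := by
  obtain ⟨u, h1, h2, h3⟩ := M.graph.median p q r
  simp only [M.le_iff] at *
  exact ⟨u, M.height.convex_up M.graph _ _ hxp _ hxr u h3,
    M.height.convex_up M.graph _ _ hyp _ hyq u h1, M.height.convex_up M.graph _ _ hzq _ hzr u h2⟩

/-- Meet and join both lie between `a` and `b`; evaluate δ through each. -/
theorem modular_eq (M : IsOrderedModular Γ g δ ψ φ) {a b w u : V} (hw : IsGLB {a, b} w)
    (hu : IsLUB {a, b} u) : φ a + φ b = φ w + φ u := by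
  have h1 := M.metric.btw _ _ _ (M.btw_of_isGLB hw)
  have h2 := M.metric.btw _ _ _ (M.btw_of_isLUB hu)
  rw [M.metric.symm a w, M.delta_eq (hw.1 (by simp)), M.delta_eq (hw.1 (by simp))] at h1
  rw [M.metric.symm u b, M.delta_eq (hu.1 (by simp)), M.delta_eq (hu.1 (by simp))] at h2
  linarith

theorem delta_eq_of_isGLB (M : IsOrderedModular Γ g δ ψ φ) {a b w : V} (hw : IsGLB {a, b} w) :
    δ a b = φ a + φ b - 2 * φ w := by
  rw [M.metric.btw _ _ _ (M.btw_of_isGLB hw), M.metric.symm a w, M.delta_eq (hw.1 (by simp)),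
    M.delta_eq (hw.1 (by simp))]
  ring

/-- The join of `q` and `r` is `r'` and their meet is above `p`; the modular law does the rest. -/
theorem isLUB_mono (M : IsOrderedModular Γ g δ ψ φ) {p q s r r' : V} (hpq : p ≤ q)
    (hr : IsLUB {p, s} r) (hr' : IsLUB {q, s} r') : r ≤ r' ∧ φ r' - φ r ≤ φ q - φ p := by
  have hq : q ≤ r' := hr'.1 (by simp)
  have hs : s ≤ r' := hr'.1 (by simp)
  have hp' : p ≤ r := hr.1 (by simp)
  have hs' : s ≤ r := hr.1 (by simp)
  have h1 : r ≤ r' := hr.2 (by rintro _ (rfl | rfl); exacts [hpq.trans hq, hs])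
  obtain ⟨t, ht, -⟩ := M.exists_isGLB hpq hp'
  have h2 : IsLUB {q, r} r' := by
    refine ⟨by rintro _ (rfl | rfl) <;> assumption, fun c hc => hr'.2 ?_⟩
    rintro _ (rfl | rfl)
    exacts [hc (by simp), hs'.trans (hc (by simp))]
  have h3 := M.modular_eq ht h2
  have h4 := M.monotone (ht.2 (by rintro _ (rfl | rfl) <;> assumption) : p ≤ t)
  exact ⟨h1, by linarith⟩

/-- Each of two bounded-above pairs raises in one coordinate and lowers in the other. -/
theorem delta_isLUB_le (M : IsOrderedModular Γ g δ ψ φ) {x x' y y' u u' : V} (hx : x ≤ x')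
    (hy : y' ≤ y) (hu : IsLUB {x, y} u) (hu' : IsLUB {x', y'} u') :
    δ u u' ≤ (φ x' - φ x) + (φ y - φ y') := by
  have hxu : x ≤ u := hu.1 (by simp)
  have hyu : y ≤ u := hu.1 (by simp)
  -- The route goes down from `u` to `x ∨ y'` and then up to `u'`.
  obtain ⟨z, hz, -⟩ := M.exists_isLUB hxu (hy.trans hyu)
  obtain ⟨h1, h2⟩ := M.isLUB_mono hx hz hu'
  obtain ⟨h3, h4⟩ := M.isLUB_mono hy (by rwa [Set.pair_comm]) (Set.pair_comm x y ▸ hu)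
  have h5 := M.metric.triangle u z u'
  rw [M.metric.symm u z, M.delta_eq h1, M.delta_eq h3] at h5
  linarith

end IsOrderedModular

/-! ### Selected pairs: optimization over pairs with an upper bound -/

variable [PartialOrder V] {g δ : V → V → ℝ} {ψ φ : V → ℝ} {θ : ℝ}

/-- A pair of elements of the intervals `[w, a]` and `[w, b]` that is bounded above. -/
structure IsCompat (w a b x y : V) : Prop where
  left : w ≤ x
  le_left : x ≤ a
  right : w ≤ y
  le_right : y ≤ b
  bdd : ∃ u, x ≤ u ∧ y ≤ u

/-- The pair `x, y` maximizes `θ φ(x) + (1 - θ) φ(y)` among the compatible pairs, with the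
largest possible `x`. -/
structure IsSelected (φ : V → ℝ) (θ : ℝ) (w a b x y : V) : Prop where
  compat : IsCompat w a b x y
  le : ∀ x' y', IsCompat w a b x' y' → θ * φ x' + (1 - θ) * φ y' ≤ θ * φ x + (1 - θ) * φ y
  tie : ∀ x' y', IsCompat w a b x' y' →
    θ * φ x' + (1 - θ) * φ y' = θ * φ x + (1 - θ) * φ y → x' ≤ x

/-- A common refinement of two compatible pairs. -/
theorem IsOrderedModular.exists_exchange (M : IsOrderedModular Γ g δ ψ φ)
    {w a b a' b' x y x' y' : V}
    (h : IsCompat w a b x y) (h' : IsCompat w a' b' x' y') (ha : a ≤ a') (hb : b ≤ b') :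
    ∃ p q s t, IsLUB {x, x'} p ∧ IsGLB {y, y'} q ∧ IsGLB {x, x'} s ∧ IsLUB {y, y'} t ∧
      IsCompat w a' b p q ∧ IsCompat w a b' s t := by
  obtain ⟨u, hu1, hu2⟩ := h.bdd
  obtain ⟨u', hu1', hu2'⟩ := h'.bdd
  obtain ⟨p, hp, -⟩ := M.exists_isLUB (h.le_left.trans ha) h'.le_left
  obtain ⟨t, ht, -⟩ := M.exists_isLUB (h.le_right.trans hb) h'.le_right
  obtain ⟨q, hq, -⟩ := M.exists_isGLB h.right h'.right
  obtain ⟨s, hs, -⟩ := M.exists_isGLB h.left h'.left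
  have hqy : q ≤ y := hq.1 (by simp)
  have hqy' : q ≤ y' := hq.1 (by simp)
  have hsx : s ≤ x := hs.1 (by simp)
  have hsx' : s ≤ x' := hs.1 (by simp)
  have hxp : x ≤ p := hp.1 (by simp)
  have hyt : y ≤ t := ht.1 (by simp)
  refine ⟨p, q, s, t, hp, hq, hs, ht, ⟨h.left.trans hxp, hp.2 ?_, hq.2 ?_, hqy.trans h.le_right,
    ?_⟩, ⟨hs.2 ?_, hsx.trans h.le_left, h.right.trans hyt, ht.2 ?_, ?_⟩⟩
  · rintro _ (rfl | rfl)
    exacts [h.le_left.trans ha, h'.le_left]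
  · rintro _ (rfl | rfl)
    exacts [h.right, h'.right]
  · obtain ⟨v, h1, h2, h3⟩ := M.exists_upperBound (h.le_left.trans ha) h'.le_left hu1'
      (hqy'.trans hu2') hu1 (hqy.trans hu2)
    exact ⟨v, hp.2 (by rintro _ (rfl | rfl) <;> assumption), h3⟩
  · rintro _ (rfl | rfl)
    exacts [h.left, h'.left]
  · rintro _ (rfl | rfl)
    exacts [h.le_right.trans hb, h'.le_right]
  · obtain ⟨v, h1, h2, h3⟩ := M.exists_upperBound (h.le_right.trans hb) h'.le_right hu2'
      (hsx'.trans hu1') hu2 (hsx.trans hu1)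
    exact ⟨v, h3, ht.2 (by rintro _ (rfl | rfl) <;> assumption)⟩

theorem IsOrderedModular.exists_isSelected [Finite V] (M : IsOrderedModular Γ g δ ψ φ)
    {w a b : V} (ha : w ≤ a) (hb : w ≤ b) : ∃ x y, IsSelected φ θ w a b x y := by
  classical
  have hne : {p : V × V | IsCompat w a b p.1 p.2}.Nonempty :=
    ⟨(w, w), ⟨le_rfl, ha, le_rfl, hb, w, le_rfl, le_rfl⟩⟩
  obtain ⟨⟨x0, y0⟩, h0, hmax0⟩ := Set.exists_max_image _
    (fun p : V × V => θ * φ p.1 + (1 - θ) * φ p.2) (Set.toFinite _) hne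
  obtain ⟨⟨x, y⟩, ⟨h1, h2⟩, hmax⟩ := Set.exists_max_image
    {p : V × V | IsCompat w a b p.1 p.2 ∧
      θ * φ p.1 + (1 - θ) * φ p.2 = θ * φ x0 + (1 - θ) * φ y0}
    (fun p : V × V => φ p.1) (Set.toFinite _) ⟨(x0, y0), h0, rfl⟩
  simp only [Set.mem_ofPred_eq, Prod.forall] at hmax0 hmax h1 h2
  refine ⟨x, y, h1, fun x' y' h => ?_, fun x' y' h he => ?_⟩
  · rw [h2]
    exact hmax0 _ _ h
  -- By the modular law the exchanged pairs are maximizers too. Since `x` has the largest φ among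
  -- first coordinates, `x ∨ x'` cannot exceed it.
  · obtain ⟨p, q, s, t, hp, hq, hs, ht, hpq, hst⟩ := M.exists_exchange h1 h le_rfl le_rfl
    have e1 := M.modular_eq hs hp
    have e2 := M.modular_eq hq ht
    have i1 := hmax0 _ _ hpq
    have i2 := hmax0 _ _ hst
    have e3 : θ * φ p + (1 - θ) * φ q + (θ * φ s + (1 - θ) * φ t) =
        θ * φ x + (1 - θ) * φ y + (θ * φ x' + (1 - θ) * φ y') := by
      linear_combination -θ * e1 - (1 - θ) * e2
    have i3 := hmax p q ⟨hpq, by linarith⟩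
    have hxp : x ≤ p := hp.1 (by simp)
    rw [M.eq_of_le hxp i3]
    exact hp.1 (by simp)

namespace IsSelected

theorem unique (M : IsOrderedModular Γ g δ ψ φ) (hθ : θ < 1) {w a b x y x' y' : V}
    (h : IsSelected φ θ w a b x y) (h' : IsSelected φ θ w a b x' y') : x = x' ∧ y = y' := by
  have e1 : θ * φ x' + (1 - θ) * φ y' = θ * φ x + (1 - θ) * φ y :=
    le_antisymm (h.le _ _ h'.compat) (h'.le _ _ h.compat)
  obtain rfl : x = x' := le_antisymm (h'.tie _ _ h.compat e1.symm) (h.tie _ _ h'.compat e1)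
  refine ⟨rfl, ?_⟩
  have e2 : φ y' = φ y := mul_left_cancel₀ (by linarith : 1 - θ ≠ 0) (by linarith)
  obtain ⟨p, q, s, t, hp, hq, hs, ht, hpq, hst⟩ :=
    M.exists_exchange h.compat h'.compat le_rfl le_rfl
  have hsx : s = x := hs.unique (by simp)
  subst hsx
  have i := h.le _ _ hst
  have i' : φ t ≤ φ y := le_of_mul_le_mul_left (by linarith) (by linarith : 0 < 1 - θ)
  rw [M.eq_of_le (ht.1 (by simp) : y ≤ t) i', M.eq_of_le (ht.1 (by simp) : y' ≤ t) (by linarith)]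

variable {w a b x y u : V}

/-- Replacing `x` by the meet of `a` and `u` keeps the pair bounded by `u`, so optimality forbids
that it be larger. -/
theorem isGLB_left (M : IsOrderedModular Γ g δ ψ φ) (hθ : 0 < θ)
    (h : IsSelected φ θ w a b x y) (hu : IsLUB {x, y} u) : IsGLB {a, u} x := by
  have hxu : x ≤ u := hu.1 (by simp)
  obtain ⟨p, hp, -⟩ := M.exists_isGLB h.compat.le_left hxu
  have hxp : x ≤ p := hp.2 (by rintro _ (rfl | rfl); exacts [h.compat.le_left, hxu])
  have i := h.le p y ⟨h.compat.left.trans hxp, hp.1 (by simp), h.compat.right,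
    h.compat.le_right, u, hp.1 (by simp), hu.1 (by simp)⟩
  have i' : φ p ≤ φ x := le_of_mul_le_mul_left (by linarith) hθ
  rwa [M.eq_of_le hxp i']

theorem isGLB_right (M : IsOrderedModular Γ g δ ψ φ) (hθ : θ < 1)
    (h : IsSelected φ θ w a b x y) (hu : IsLUB {x, y} u) : IsGLB {b, u} y := by
  have hyu : y ≤ u := hu.1 (by simp)
  obtain ⟨p, hp, -⟩ := M.exists_isGLB h.compat.le_right hyu
  have hyp : y ≤ p := hp.2 (by rintro _ (rfl | rfl); exacts [h.compat.le_right, hyu])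
  have i := h.le x p ⟨h.compat.left, h.compat.le_left, h.compat.right.trans hyp,
    hp.1 (by simp), u, hu.1 (by simp), hp.1 (by simp)⟩
  have i' : φ p ≤ φ y := le_of_mul_le_mul_left (by linarith) (by linarith : 0 < 1 - θ)
  rwa [M.eq_of_le hyp i']

theorem isGLB (h : IsSelected φ θ w a b x y) (hw : IsGLB {a, b} w) : IsGLB {x, y} w := by
  refine ⟨?_, fun c hc => hw.2 ?_⟩
  · rintro _ (rfl | rfl)
    exacts [h.compat.left, h.compat.right]
  · rintro _ (rfl | rfl)
    exacts [(hc (by simp : x ∈ _)).trans h.compat.le_left,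
      (hc (by simp : y ∈ _)).trans h.compat.le_right]

/-- The join and the meet of `x, y` give the same distance from `x` to `y`, so going from `a`
through `x, u, y` to `b` is as short as going through `w`. -/
theorem btw (M : IsOrderedModular Γ g δ ψ φ) (hθ : 0 < θ) (hθ' : θ < 1)
    (h : IsSelected φ θ w a b x y) (hu : IsLUB {x, y} u) (hw : IsGLB {a, b} w) : Btw Γ a u b := by
  have hwx := h.isGLB hw
  have h1 := M.btw_of_isGLB (h.isGLB_left M hθ hu)
  have h2 := M.btw_of_isGLB (h.isGLB_right M hθ' hu)
  have h3 := M.btw_of_isGLB hw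
  have h4 := M.btw_of_isGLB hwx
  have h5 := M.btw_of_isLUB hu
  have h6 := M.btw_of_le h.compat.left h.compat.le_left
  have h7 := M.btw_of_le h.compat.right h.compat.le_right
  unfold Btw at *
  have c1 := Γ.dist_comm (u := a) (v := x)
  have c2 := Γ.dist_comm (u := b) (v := y)
  have c3 := Γ.dist_comm (u := a) (v := w)
  have c4 := Γ.dist_comm (u := x) (v := w)
  have c5 := Γ.dist_comm (u := y) (v := u)
  have c6 := Γ.dist_comm (u := b) (v := u)
  omega

end IsSelected

end ModularGraph

namespace ModularGraph

/-! ### How the selected pair depends on `a` and `b` -/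

variable {V : Type*} {Γ : SimpleGraph V}
variable [PartialOrder V] {g δ : V → V → ℝ} {ψ φ : V → ℝ} {θ : ℝ}

namespace IsSelected

/-- Raising `a` with the same greatest lower bound raises `x` and lowers `y`. -/
theorem mono_left (M : IsOrderedModular Γ g δ ψ φ) (hθ : θ < 1) {w a a' b x y x' y' : V}
    (ha : a ≤ a') (h : IsSelected φ θ w a b x y) (h' : IsSelected φ θ w a' b x' y') :
    x ≤ x' ∧ y' ≤ y := by
  obtain ⟨p, q, s, t, hp, hq, hs, ht, hpq, hst⟩ :=
    M.exists_exchange h.compat h'.compat ha le_rfl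
  have e1 := M.modular_eq hs hp
  have e2 := M.modular_eq hq ht
  have i1 := h'.le _ _ hpq
  have i2 := h.le _ _ hst
  -- The exchanged pairs compete in the two problems with the same total as the two optima, so each
  -- of them is optimal for its own problem.
  have e3 : θ * φ p + (1 - θ) * φ q + (θ * φ s + (1 - θ) * φ t) =
      θ * φ x + (1 - θ) * φ y + (θ * φ x' + (1 - θ) * φ y') := by
    linear_combination -θ * e1 - (1 - θ) * e2
  have hx : x ≤ x' := (hp.1 (by simp)).trans (h'.tie p q hpq (by linarith))
  obtain rfl : s = x := hs.unique (by
    refine ⟨by rintro _ (rfl | rfl) <;> first | exact le_rfl | assumption, fun c hc => hc (by simp)⟩)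
  have i' : φ t ≤ φ y := le_of_mul_le_mul_left (by linarith) (by linarith : 0 < 1 - θ)
  refine ⟨hx, ?_⟩
  rw [M.eq_of_le (ht.1 (by simp) : y ≤ t) i']
  exact ht.1 (by simp)

/-- Raising `b` with the same greatest lower bound lowers `x` and raises `y`. -/
theorem mono_right (M : IsOrderedModular Γ g δ ψ φ) (hθ : θ < 1) {w a b b' x y x' y' : V}
    (hb : b ≤ b') (h : IsSelected φ θ w a b x y) (h' : IsSelected φ θ w a b' x' y') :
    x' ≤ x ∧ y ≤ y' := by
  obtain ⟨p, q, s, t, hp, hq, hs, ht, hpq, hst⟩ :=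
    M.exists_exchange h.compat h'.compat le_rfl hb
  have e1 := M.modular_eq hs hp
  have e2 := M.modular_eq hq ht
  have i1 := h.le _ _ hpq
  have i2 := h'.le _ _ hst
  have e3 : θ * φ p + (1 - θ) * φ q + (θ * φ s + (1 - θ) * φ t) =
      θ * φ x + (1 - θ) * φ y + (θ * φ x' + (1 - θ) * φ y') := by
    linear_combination -θ * e1 - (1 - θ) * e2
  have hx : x' ≤ x := (hp.1 (by simp)).trans (h.tie p q hpq (by linarith))
  obtain rfl : s = x' := hs.unique (by
    refine ⟨by rintro _ (rfl | rfl) <;> first | exact le_rfl | assumption, fun c hc => hc (by simp)⟩)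
  have i' : φ t ≤ φ y' := le_of_mul_le_mul_left (by linarith) (by linarith : 0 < 1 - θ)
  refine ⟨hx, ?_⟩
  rw [M.eq_of_le (ht.1 (by simp) : y' ≤ t) i']
  exact ht.1 (by simp)

end IsSelected

theorem IsOrderedModular.eq_or_eq_of_adj (M : IsOrderedModular Γ g δ ψ φ) {a a' l : V}
    (hadj : Γ.Adj a a') (h1 : a ≤ l) (h2 : l ≤ a') : l = a ∨ l = a' := by
  have h3 := M.btw_of_le h1 h2
  unfold Btw at h3
  rw [SimpleGraph.dist_eq_one_iff_adj.2 hadj] at h3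
  rcases Nat.eq_zero_or_pos (Γ.dist a l) with h | h
  · exact Or.inl (M.graph.eq_of_dist h).symm
  · exact Or.inr (M.graph.eq_of_dist (by omega))

/-- Moving `a` up along an edge that changes the greatest lower bound with `b`. -/
structure IsShift (Γ : SimpleGraph V) (a a' b w w' : V) : Prop where
  adj : Γ.Adj a a'
  le : a ≤ a'
  glb : IsGLB {a, b} w
  glb' : IsGLB {a', b} w'
  ne : w ≠ w'

namespace IsShift

variable {a a' b w w' : V}

theorem le_w (h : IsShift Γ a a' b w w') : w ≤ w' :=
  h.glb'.2 (by
    rintro _ (rfl | rfl)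
    exacts [(h.glb.1 (by simp)).trans h.le, h.glb.1 (by simp)])

/-- Nothing lies strictly between `a` and `a'`. Were the join equal to `a`, then `w'` would be below
`a` and `b`, and the meet would not change. -/
theorem isLUB (h : IsShift Γ a a' b w w') (M : IsOrderedModular Γ g δ ψ φ) :
    IsLUB {a, w'} a' := by
  have hw' : w' ≤ a' := h.glb'.1 (by simp)
  obtain ⟨l, hl, -⟩ := M.exists_isLUB h.le hw'
  have h1 : l ≤ a' := hl.2 (by rintro _ (rfl | rfl); exacts [h.le, hw'])
  rcases M.eq_or_eq_of_adj h.adj (hl.1 (by simp)) h1 with rfl | rfl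
  · exact absurd (le_antisymm h.le_w
      (h.glb.2 (by rintro _ (rfl | rfl); exacts [hl.1 (by simp), h.glb'.1 (by simp)]))) h.ne
  · exact hl

theorem isGLB_of_le (h : IsShift Γ a a' b w w') {t : V} (h1 : w ≤ t) (h2 : t ≤ a) :
    IsGLB {t, w'} w := by
  refine ⟨by rintro _ (rfl | rfl); exacts [h1, h.le_w], fun c hc => h.glb.2 ?_⟩
  rintro _ (rfl | rfl)
  exacts [(hc (by simp : t ∈ _)).trans h2,
    (hc (by simp : w' ∈ _)).trans (h.glb'.1 (by simp))]

theorem isLUB_of_le (h : IsShift Γ a a' b w w') (M : IsOrderedModular Γ g δ ψ φ) {t : V}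
    (h1 : w' ≤ t) (h2 : t ≤ a') : IsLUB {a, t} a' := by
  refine ⟨by rintro _ (rfl | rfl); exacts [h.le, h2], fun c hc => (h.isLUB M).2 ?_⟩
  rintro _ (rfl | rfl)
  exacts [hc (by simp), h1.trans (hc (by simp))]

theorem phi_eq (h : IsShift Γ a a' b w w') (M : IsOrderedModular Γ g δ ψ φ) {t r : V}
    (h1 : w ≤ t) (h2 : t ≤ a) (hr : IsLUB {t, w'} r) : φ r = φ t + φ w' - φ w := by
  have := M.modular_eq (h.isGLB_of_le h1 h2) hr
  linarith

theorem delta_eq (h : IsShift Γ a a' b w w') (M : IsOrderedModular Γ g δ ψ φ) :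
    δ w w' = δ a a' := by
  rw [M.delta_eq h.le_w, M.delta_eq h.le, h.phi_eq M (h.glb.1 (by simp)) le_rfl (h.isLUB M)]
  ring

/-- An element of `[w', a']` is the join of `w'` and its meet with `a`. -/
theorem exists_decomp (h : IsShift Γ a a' b w w') (M : IsOrderedModular Γ g δ ψ φ) {t : V}
    (h1 : w' ≤ t) (h2 : t ≤ a') : ∃ s, w ≤ s ∧ s ≤ a ∧ s ≤ t ∧ IsLUB {s, w'} t := by
  have hwa : w ≤ a := h.glb.1 (by simp)
  obtain ⟨s, hs, -⟩ := M.exists_isGLB hwa (h.le_w.trans h1)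
  have hws : w ≤ s := hs.2 (by rintro _ (rfl | rfl); exacts [hwa, h.le_w.trans h1])
  have hsa : s ≤ a := hs.1 (by simp)
  have hst : s ≤ t := hs.1 (by simp)
  obtain ⟨r, hr, -⟩ := M.exists_isLUB hst h1
  have e1 := M.modular_eq hs (h.isLUB_of_le M h1 h2)
  have e2 := h.phi_eq M hws hsa hr
  have e3 := h.phi_eq M hwa le_rfl (h.isLUB M)
  have hrt : r ≤ t := hr.2 (by rintro _ (rfl | rfl) <;> assumption)
  obtain rfl := M.eq_of_le hrt (by linarith)
  exact ⟨s, hws, hsa, hst, hr⟩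

end IsShift

namespace IsSelected

variable {a a' b b' w w' x y u u' p q : V}

/-- The meet moves while the join `x ∨ y` stays put. Here `w'` can be joined to `y` without losing
boundedness, so optimality gives `w' ≤ y`. Joining with `w'` carries `[w, a]` onto `[w', a']` and
adds the constant `φ w' - φ w`, so optimal pairs go to optimal pairs. -/
theorem shift_left (M : IsOrderedModular Γ g δ ψ φ) (hθ' : θ < 1)
    (hs : IsShift Γ a a' b w w') (h : IsSelected φ θ w a b x y) :
    w' ≤ y ∧ ∃ x', IsLUB {x, w'} x' ∧ IsSelected φ θ w' a' b x' y := by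
  have hw'a' : w' ≤ a' := hs.glb'.1 (by simp)
  have hw'b : w' ≤ b := hs.glb'.1 (by simp)
  have hxa' := h.compat.le_left.trans hs.le
  obtain ⟨u, hxu, hyu⟩ := h.compat.bdd
  obtain ⟨v, hv1, hv2, hv3⟩ := M.exists_upperBound hxa' hw'a' hw'b h.compat.le_right hxu hyu
  obtain ⟨t, ht, -⟩ := M.exists_isLUB hv2 hv3
  have hyt : y ≤ t := ht.1 (by simp)
  have i := h.le x t ⟨h.compat.left, h.compat.le_left, h.compat.right.trans hyt,
    ht.2 (by rintro _ (rfl | rfl); exacts [hw'b, h.compat.le_right]), v, hv1,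
    ht.2 (by rintro _ (rfl | rfl); exacts [hv2, hv3])⟩
  have i' : φ t ≤ φ y := le_of_mul_le_mul_left (by linarith) (by linarith : 0 < 1 - θ)
  have hwy : w' ≤ y := by
    rw [M.eq_of_le hyt i']
    exact ht.1 (by simp)
  obtain ⟨x', hx', -⟩ := M.exists_isLUB hv1 hv2
  refine ⟨hwy, x', hx', ⟨hx'.1 (by simp), hx'.2 (by rintro _ (rfl | rfl) <;> assumption), hwy,
    h.compat.le_right, v, hx'.2 (by rintro _ (rfl | rfl) <;> assumption), hv3⟩, ?_, ?_⟩
  all_goals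
    intro x1 y1 h1
    obtain ⟨s, hs1, hs2, hs3, hs4⟩ := hs.exists_decomp M h1.left h1.le_left
    obtain ⟨v1, hv1x, hv1y⟩ := h1.bdd
    have hc : IsCompat w a b s y1 :=
      ⟨hs1, hs2, hs.le_w.trans h1.right, h1.le_right, v1, hs3.trans hv1x, hv1y⟩
    rw [hs.phi_eq M hs1 hs2 hs4, hs.phi_eq M h.compat.left h.compat.le_left hx']
  · linarith [h.le _ _ hc]
  · intro he
    have := h.tie _ _ hc (by linarith)
    refine hs4.2 ?_
    rintro _ (rfl | rfl)
    exacts [this.trans (hx'.1 (by simp)), hx'.1 (by simp)]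

theorem shift_right (M : IsOrderedModular Γ g δ ψ φ) (hθ : 0 < θ)
    (hs : IsShift Γ b b' a w w') (h : IsSelected φ θ w a b x y) :
    w' ≤ x ∧ ∃ y', IsLUB {y, w'} y' ∧ IsSelected φ θ w' a b' x y' := by
  have hw'b' : w' ≤ b' := hs.glb'.1 (by simp)
  have hw'a : w' ≤ a := hs.glb'.1 (by simp)
  have hyb' := h.compat.le_right.trans hs.le
  obtain ⟨u, hxu, hyu⟩ := h.compat.bdd
  obtain ⟨v, hv1, hv2, hv3⟩ := M.exists_upperBound hyb' hw'b' hw'a h.compat.le_left hyu hxu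
  obtain ⟨t, ht, -⟩ := M.exists_isLUB hv2 hv3
  have hxt : x ≤ t := ht.1 (by simp)
  have i := h.le t y ⟨h.compat.left.trans hxt,
    ht.2 (by rintro _ (rfl | rfl); exacts [hw'a, h.compat.le_left]), h.compat.right,
    h.compat.le_right, v, ht.2 (by rintro _ (rfl | rfl); exacts [hv2, hv3]), hv1⟩
  have i' : φ t ≤ φ x := le_of_mul_le_mul_left (by linarith) hθ
  have hwx : w' ≤ x := by
    rw [M.eq_of_le hxt i']
    exact ht.1 (by simp)
  obtain ⟨y', hy', -⟩ := M.exists_isLUB hv1 hv2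
  refine ⟨hwx, y', hy', ⟨hwx, h.compat.le_left, hy'.1 (by simp),
    hy'.2 (by rintro _ (rfl | rfl) <;> assumption), v, hv3,
    hy'.2 (by rintro _ (rfl | rfl) <;> assumption)⟩, ?_, ?_⟩
  all_goals
    intro x1 y1 h1
    obtain ⟨s, hs1, hs2, hs3, hs4⟩ := hs.exists_decomp M h1.right h1.le_right
    obtain ⟨v1, hv1x, hv1y⟩ := h1.bdd
    have hc : IsCompat w a b x1 s :=
      ⟨hs.le_w.trans h1.left, h1.le_left, hs1, hs2, v1, hv1x, hs3.trans hv1y⟩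
    rw [hs.phi_eq M hs1 hs2 hs4, hs.phi_eq M h.compat.right h.compat.le_right hy']
  · linarith [h.le _ _ hc]
  · intro he
    exact h.tie _ _ hc (by linarith)

end IsSelected

theorem isLUB_of_isLUB_pair {x y w x' u : V} (hx' : IsLUB {x, w} x') (hwy : w ≤ y)
    (hu : IsLUB {x, y} u) : IsLUB {x', y} u := by
  have hyu : y ≤ u := hu.1 (by simp)
  refine ⟨?_, fun c hc => hu.2 ?_⟩
  · rintro _ (rfl | rfl)
    · refine hx'.2 ?_
      rintro _ (rfl | rfl)
      exacts [hu.1 (by simp), hwy.trans hyu]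
    · exact hyu
  · rintro _ (rfl | rfl)
    exacts [(hx'.1 (by simp)).trans (hc (by simp : x' ∈ _)), hc (by simp)]

/-! ### Families of joins and their total displacement -/

/-- `w` is the greatest lower bound of `a` and `b`, and `u k` is the join of the pair selected
for the parameter `k / N`. -/
structure IsJoinFamily (φ : V → ℝ) (N : ℕ) (a b w : V) (u : ℕ → V) : Prop where
  glb : IsGLB {a, b} w
  sel : ∀ k, 0 < k → k < N → ∃ x y, IsSelected φ ((k : ℝ) / N) w a b x y ∧ IsLUB {x, y} (u k)

theorem param_pos {k N : ℕ} (h : 0 < k) (h' : k < N) : (0 : ℝ) < (k : ℝ) / N :=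
  div_pos (by exact_mod_cast h) (by exact_mod_cast h.trans h')

theorem param_lt_one {k N : ℕ} (h' : k < N) : (k : ℝ) / N < 1 := by
  rw [div_lt_one (by exact_mod_cast (Nat.zero_le k).trans_lt h')]
  exact_mod_cast h'

theorem exists_isJoinFamily [Finite V] (M : IsOrderedModular Γ g δ ψ φ) (N : ℕ) {a b m : V}
    (ha : m ≤ a) (hb : m ≤ b) : ∃ w u, IsJoinFamily φ N a b w u := by
  obtain ⟨w, hw, -⟩ := M.exists_isGLB ha hb
  have : ∀ k : ℕ, ∃ u, ∃ x y, IsSelected φ ((k : ℝ) / N) w a b x y ∧ IsLUB {x, y} u := by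
    intro k
    obtain ⟨x, y, h⟩ := M.exists_isSelected (φ := φ) (θ := (k : ℝ) / N)
      (hw.1 (by simp) : w ≤ a) (hw.1 (by simp) : w ≤ b)
    obtain ⟨v, h1, h2⟩ := h.compat.bdd
    obtain ⟨u, hu, -⟩ := M.exists_isLUB h1 h2
    exact ⟨u, x, y, h, hu⟩
  choose u hu using this
  exact ⟨w, u, hw, fun k _ _ => hu k⟩

theorem IsJoinFamily.unique (M : IsOrderedModular Γ g δ ψ φ) {N : ℕ} {a b w w' : V}
    {u u' : ℕ → V} (h : IsJoinFamily φ N a b w u) (h' : IsJoinFamily φ N a b w' u') :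
    w = w' ∧ ∀ k, 0 < k → k < N → u k = u' k := by
  obtain rfl := h.glb.unique h'.glb
  refine ⟨rfl, fun k h0 hN => ?_⟩
  obtain ⟨x, y, h1, h2⟩ := h.sel k h0 hN
  obtain ⟨x', y', h1', h2'⟩ := h'.sel k h0 hN
  obtain ⟨rfl, rfl⟩ := h1.unique M (param_lt_one hN) h1'
  exact h2.unique h2'

theorem IsJoinFamily.btw (M : IsOrderedModular Γ g δ ψ φ) {N : ℕ} {a b w : V}
    {u : ℕ → V} (h : IsJoinFamily φ N a b w u) {k : ℕ} (h0 : 0 < k) (hN : k < N) :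
    Btw Γ a (u k) b := by
  obtain ⟨x, y, h1, h2⟩ := h.sel k h0 hN
  exact h1.btw M (param_pos h0 hN) (param_lt_one hN) h2 h.glb

theorem IsJoinFamily.exists_pairs {N : ℕ} {a b w : V} {u : ℕ → V}
    (h : IsJoinFamily φ N a b w u) : ∃ x y : ℕ → V, ∀ k, 0 < k → k < N →
      IsSelected φ ((k : ℝ) / N) w a b (x k) (y k) ∧ IsLUB {x k, y k} (u k) := by
  have : ∀ k, ∃ x y, 0 < k → k < N →
      IsSelected φ ((k : ℝ) / N) w a b x y ∧ IsLUB {x, y} (u k) := by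
    intro k
    by_cases hk : 0 < k ∧ k < N
    · obtain ⟨x, y, h1⟩ := h.sel k hk.1 hk.2
      exact ⟨x, y, fun _ _ => h1⟩
    · exact ⟨w, w, fun h1 h2 => absurd ⟨h1, h2⟩ hk⟩
  choose x y hxy using this
  exact ⟨x, y, hxy⟩

theorem sum_Ioo_zero (f : ℕ → ℝ) (n : ℕ) :
    ∑ k ∈ Finset.Ioo 0 (n + 1), f k = ∑ k ∈ Finset.range n, f (k + 1) := by
  have h : Finset.Ioo 0 (n + 1) = Finset.Ico 1 (n + 1) := by
    ext k
    simp only [Finset.mem_Ioo, Finset.mem_Ico]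
    omega
  rw [h, Finset.sum_Ico_eq_sum_range]
  simp [add_comm]

/-- Bounds on the sum of the differences `φ(x) - φ(y)` over the selected pairs. -/
theorem IsOrderedModular.sum_bounds (M : IsOrderedModular Γ g δ ψ φ) {N : ℕ} (hN : 0 < N)
    {a b w : V} (hw : IsGLB {a, b} w) {x y : ℕ → V}
    (h : ∀ k, 0 < k → k < N → IsSelected φ ((k : ℝ) / N) w a b (x k) (y k)) :
    ∑ k ∈ Finset.Ioo 0 N, (φ (x k) - φ (y k)) ≤ N * (φ a - φ b) + (φ b - φ w) ∧
      N * (φ a - φ b) - (φ a - φ w) ≤ ∑ k ∈ Finset.Ioo 0 N, (φ (x k) - φ (y k)) := by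
  have hN' : (0 : ℝ) < N := by exact_mod_cast hN
  have hwa : w ≤ a := hw.1 (by simp)
  have hwb : w ≤ b := hw.1 (by simp)
  -- The endpoints are added by hand: `(w, b)` is optimal for parameter 0 and `(a, w)` for parameter
  -- 1.
  let X : ℕ → V := fun k => if k = 0 then w else if k = N then a else x k
  let Y : ℕ → V := fun k => if k = 0 then b else if k = N then w else y k
  have hX0 : X 0 = w := by simp [X]
  have hY0 : Y 0 = b := by simp [Y]
  have hXN : X N = a := by simp [X, hN.ne']
  have hYN : Y N = w := by simp [Y, hN.ne']
  have hXY : ∀ k, 0 < k → k < N → X k = x k ∧ Y k = y k := fun k h1 h2 => by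
    simp [X, Y, h1.ne', h2.ne]
  have hopt : ∀ k ≤ N, IsCompat w a b (X k) (Y k) ∧ ∀ x' y', IsCompat w a b x' y' →
      k * φ x' + (N - k) * φ y' ≤ k * φ (X k) + (N - k) * φ (Y k) := by
    intro k hk
    rcases Nat.eq_zero_or_pos k with rfl | h0
    · rw [hX0, hY0]
      refine ⟨⟨le_rfl, hwa, hwb, le_rfl, b, hwb, le_rfl⟩, fun x' y' h' => ?_⟩
      have := mul_le_mul_of_nonneg_left (M.monotone h'.le_right) hN'.le
      push_cast
      linarith
    rcases hk.eq_or_lt with rfl | h1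
    · rw [hXN, hYN]
      refine ⟨⟨hwa, le_rfl, le_rfl, hwb, a, le_rfl, hwa⟩, fun x' y' h' => ?_⟩
      have := mul_le_mul_of_nonneg_left (M.monotone h'.le_left) hN'.le
      linarith
    · rw [(hXY k h0 h1).1, (hXY k h0 h1).2]
      refine ⟨(h k h0 h1).compat, fun x' y' h' => ?_⟩
      have := mul_le_mul_of_nonneg_left ((h k h0 h1).le _ _ h') hN'.le
      have e : ∀ p q : ℝ, (N : ℝ) * ((k : ℝ) / N * p + (1 - (k : ℝ) / N) * q) =
          k * p + (N - k) * q := by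
        intro p q
        field_simp
      rwa [e, e] at this
  let s : ℕ → ℝ := fun k => φ (X k) - φ (Y k)
  -- The optimal value, scaled by `N`. It is convex in `k` with slope `s k`, so the slopes interlace
  -- with its increments, which telescope to `N (φ a - φ b)`.
  let A : ℕ → ℝ := fun k => k * φ (X k) + (N - k) * φ (Y k)
  have hs : ∀ k < N, s k ≤ A (k + 1) - A k ∧ A (k + 1) - A k ≤ s (k + 1) := by
    intro k hk
    have h1 := (hopt k hk.le).2 _ _ (hopt (k + 1) hk).1
    have h2 := (hopt (k + 1) hk).2 _ _ (hopt k hk.le).1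
    simp only [s, A]
    push_cast at h1 h2 ⊢
    constructor <;> linarith
  have hA : ∑ k ∈ Finset.range N, (A (k + 1) - A k) = N * (φ a - φ b) := by
    rw [Finset.sum_range_sub]
    simp only [A, hX0, hY0, hXN, hYN]
    push_cast
    ring
  have h1 := Finset.sum_le_sum fun k hk => (hs k (Finset.mem_range.1 hk)).1
  have h2 := Finset.sum_le_sum fun k hk => (hs k (Finset.mem_range.1 hk)).2
  rw [hA] at h1 h2
  have h3 : ∑ k ∈ Finset.Ioo 0 N, (φ (x k) - φ (y k)) = ∑ k ∈ Finset.Ioo 0 N, s k := by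
    refine Finset.sum_congr rfl fun k hk => ?_
    rw [Finset.mem_Ioo] at hk
    simp only [s, hXY k hk.1 hk.2]
  rw [h3]
  have h4 : s 0 = φ w - φ b := by simp only [s, hX0, hY0]
  have h5 : s N = φ a - φ w := by simp only [s, hXN, hYN]
  obtain ⟨n, rfl⟩ : ∃ n, N = n + 1 := ⟨N - 1, by omega⟩
  rw [Finset.sum_range_succ'] at h1
  rw [Finset.sum_range_succ] at h2
  rw [sum_Ioo_zero]
  constructor <;> linarith

/-- Total distance between two families of joins. -/
noncomputable def familyDist (δ : V → V → ℝ) (N : ℕ) (w w' : V) (u u' : ℕ → V) : ℝ :=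
  N * δ w w' + ∑ k ∈ Finset.Ioo 0 N, δ (u k) (u' k)

theorem familyDist_symm (M : IsOrderedModular Γ g δ ψ φ) (N : ℕ) (w w' : V) (u u' : ℕ → V) :
    familyDist δ N w w' u u' = familyDist δ N w' w u' u := by
  simp only [familyDist, M.metric.symm w w']
  congr 1
  exact Finset.sum_congr rfl fun k _ => M.metric.symm _ _

theorem familyDist_triangle (M : IsOrderedModular Γ g δ ψ φ) (N : ℕ) (w w' w'' : V)
    (u u' u'' : ℕ → V) : familyDist δ N w w'' u u'' ≤
      familyDist δ N w w' u u' + familyDist δ N w' w'' u' u'' := by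
  simp only [familyDist]
  have h1 := mul_le_mul_of_nonneg_left (M.metric.triangle w w' w'') (Nat.cast_nonneg (α := ℝ) N)
  have h2 : ∑ k ∈ Finset.Ioo 0 N, δ (u k) (u'' k) ≤
      ∑ k ∈ Finset.Ioo 0 N, (δ (u k) (u' k) + δ (u' k) (u'' k)) :=
    Finset.sum_le_sum fun k _ => M.metric.triangle _ _ _
  rw [Finset.sum_add_distrib] at h2
  linarith

namespace IsJoinFamily

variable {N : ℕ} {a a' b b' w w' : V} {u u' : ℕ → V}

theorem familyDist_of_unique (M : IsOrderedModular Γ g δ ψ φ) (h : IsJoinFamily φ N a b w u)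
    (h' : IsJoinFamily φ N a b w' u') : familyDist δ N w w' u u' = 0 := by
  obtain ⟨rfl, h2⟩ := h.unique M h'
  simp only [familyDist, M.metric.self, mul_zero, zero_add]
  refine Finset.sum_eq_zero fun k hk => ?_
  rw [Finset.mem_Ioo] at hk
  rw [h2 k hk.1 hk.2, M.metric.self]

/-- If the meet is unchanged, `x` rises and `y` falls for every `k`, so each join moves by at most
the increase of `φ x - φ y`; `sum_bounds` totals this up to the boundary terms `δ a b`. If the meet
changes, it moves by `δ a a'` and all joins stay fixed. -/
theorem familyDist_up_left (M : IsOrderedModular Γ g δ ψ φ) (hN : 0 < N) (hadj : Γ.Adj a a')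
    (ha : a ≤ a') (h : IsJoinFamily φ N a b w u) (h' : IsJoinFamily φ N a' b w' u') :
    familyDist δ N w w' u u' ≤ N * δ a a' + δ a b := by
  obtain ⟨x, y, hxy⟩ := h.exists_pairs
  obtain ⟨x', y', hxy'⟩ := h'.exists_pairs
  by_cases hw : w = w'
  · subst hw
    have h1 := (M.sum_bounds hN h.glb fun k h0 h1 => (hxy k h0 h1).1).2
    have h2 := (M.sum_bounds hN h'.glb fun k h0 h1 => (hxy' k h0 h1).1).1
    have h3 : ∑ k ∈ Finset.Ioo 0 N, δ (u k) (u' k) ≤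
        ∑ k ∈ Finset.Ioo 0 N, ((φ (x' k) - φ (y' k)) - (φ (x k) - φ (y k))) := by
      refine Finset.sum_le_sum fun k hk => ?_
      rw [Finset.mem_Ioo] at hk
      obtain ⟨i1, i2⟩ := hxy k hk.1 hk.2
      obtain ⟨i3, i4⟩ := hxy' k hk.1 hk.2
      obtain ⟨i5, i6⟩ := i1.mono_left M (param_lt_one hk.2) ha i3
      linarith [M.delta_isLUB_le i5 i6 i2 i4]
    rw [Finset.sum_sub_distrib] at h3
    rw [familyDist, M.metric.self, M.delta_eq ha, M.delta_eq_of_isGLB h.glb]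
    linarith
  · have hs : IsShift Γ a a' b w w' := ⟨hadj, ha, h.glb, h'.glb, hw⟩
    have h3 : ∑ k ∈ Finset.Ioo 0 N, δ (u k) (u' k) = 0 := by
      refine Finset.sum_eq_zero fun k hk => ?_
      rw [Finset.mem_Ioo] at hk
      obtain ⟨i1, i2⟩ := hxy k hk.1 hk.2
      obtain ⟨i3, i4⟩ := hxy' k hk.1 hk.2
      obtain ⟨i5, x'', i6, i7⟩ := i1.shift_left M (param_lt_one hk.2) hs
      obtain ⟨i8, i9⟩ := i3.unique M (param_lt_one hk.2) i7
      rw [i8, i9] at i4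
      rw [(isLUB_of_isLUB_pair i6 i5 i2).unique i4, M.metric.self]
    rw [familyDist, h3, hs.delta_eq M]
    linarith [M.metric.nonneg a b]

theorem familyDist_up_right (M : IsOrderedModular Γ g δ ψ φ) (hN : 0 < N) (hadj : Γ.Adj b b')
    (hb : b ≤ b') (h : IsJoinFamily φ N a b w u) (h' : IsJoinFamily φ N a b' w' u') :
    familyDist δ N w w' u u' ≤ N * δ b b' + δ a b := by
  obtain ⟨x, y, hxy⟩ := h.exists_pairs
  obtain ⟨x', y', hxy'⟩ := h'.exists_pairs
  by_cases hw : w = w'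
  · subst hw
    have h1 := (M.sum_bounds hN h.glb fun k h0 h1 => (hxy k h0 h1).1).1
    have h2 := (M.sum_bounds hN h'.glb fun k h0 h1 => (hxy' k h0 h1).1).2
    have h3 : ∑ k ∈ Finset.Ioo 0 N, δ (u k) (u' k) ≤
        ∑ k ∈ Finset.Ioo 0 N, ((φ (x k) - φ (y k)) - (φ (x' k) - φ (y' k))) := by
      refine Finset.sum_le_sum fun k hk => ?_
      rw [Finset.mem_Ioo] at hk
      obtain ⟨i1, i2⟩ := hxy k hk.1 hk.2
      obtain ⟨i3, i4⟩ := hxy' k hk.1 hk.2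
      obtain ⟨i5, i6⟩ := i1.mono_right M (param_lt_one hk.2) hb i3
      have := M.delta_isLUB_le i5 i6 i4 i2
      rw [M.metric.symm] at this
      linarith
    rw [Finset.sum_sub_distrib] at h3
    rw [familyDist, M.metric.self, M.delta_eq hb, M.delta_eq_of_isGLB h.glb]
    linarith
  · have hs : IsShift Γ b b' a w w' :=
      ⟨hadj, hb, Set.pair_comm a b ▸ h.glb, Set.pair_comm a b' ▸ h'.glb, hw⟩
    have h3 : ∑ k ∈ Finset.Ioo 0 N, δ (u k) (u' k) = 0 := by
      refine Finset.sum_eq_zero fun k hk => ?_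
      rw [Finset.mem_Ioo] at hk
      obtain ⟨i1, i2⟩ := hxy k hk.1 hk.2
      obtain ⟨i3, i4⟩ := hxy' k hk.1 hk.2
      obtain ⟨i5, y'', i6, i7⟩ := i1.shift_right M (param_pos hk.1 hk.2) hs
      obtain ⟨i8, i9⟩ := i3.unique M (param_lt_one hk.2) i7
      rw [i8, i9] at i4
      rw [Set.pair_comm] at i2 i4
      rw [(isLUB_of_isLUB_pair i6 i5 i2).unique i4, M.metric.self]
    rw [familyDist, h3, hs.delta_eq M]
    linarith [M.metric.nonneg a b]

variable {D : ℝ} {m : V}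

/-- Sum the one-edge estimate along a geodesic, which stays above `m` by convexity. Each edge costs
one error `D`, whatever `N` is. -/
theorem familyDist_left [Finite V] (M : IsOrderedModular Γ g δ ψ φ) (hD : ∀ a b, δ a b ≤ D)
    (hN : 0 < N) (ha : m ≤ a) (ha' : m ≤ a') (hb : m ≤ b) (h : IsJoinFamily φ N a b w u)
    (h' : IsJoinFamily φ N a' b w' u') :
    familyDist δ N w w' u u' ≤ N * δ a a' + Γ.dist a a' * D := by
  induction hn : Γ.dist a a' generalizing a w u with
  | zero =>
    obtain rfl := M.graph.eq_of_dist hn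
    simp [h.familyDist_of_unique M h', M.metric.self]
  | succ n ih =>
    have hne : a ≠ a' := by
      rintro rfl
      simp at hn
    obtain ⟨v, hav, hd⟩ := M.graph.exists_neighbor hne
    have hb1 := IsConnectedModular.btw_of_adj hav hd
    have hmv : m ≤ v := (M.le_iff _ _).2 (M.height.convex_up M.graph m a ((M.le_iff _ _).1 ha) a'
      ((M.le_iff _ _).1 ha') v hb1)
    obtain ⟨w1, u1, h1⟩ := exists_isJoinFamily M N hmv hb
    have i1 := ih hmv h1 (by omega)
    have i2 := familyDist_triangle M N w w1 w' u u1 u'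
    have i3 : familyDist δ N w w1 u u1 ≤ N * δ a v + D := by
      rcases M.height.below_or_of_adj hav with hl | hl <;> rw [← M.le_iff] at hl
      · linarith [h.familyDist_up_left M hN hav hl h1, hD a b]
      · rw [familyDist_symm M, M.metric.symm]
        linarith [h1.familyDist_up_left M hN hav.symm hl h, hD v b]
    rw [M.metric.btw _ _ _ hb1]
    push_cast
    linarith

theorem familyDist_right [Finite V] (M : IsOrderedModular Γ g δ ψ φ) (hD : ∀ a b, δ a b ≤ D)
    (hN : 0 < N) (ha : m ≤ a) (hb : m ≤ b) (hb' : m ≤ b') (h : IsJoinFamily φ N a b w u)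
    (h' : IsJoinFamily φ N a b' w' u') :
    familyDist δ N w w' u u' ≤ N * δ b b' + Γ.dist b b' * D := by
  induction hn : Γ.dist b b' generalizing b w u with
  | zero =>
    obtain rfl := M.graph.eq_of_dist hn
    simp [h.familyDist_of_unique M h', M.metric.self]
  | succ n ih =>
    have hne : b ≠ b' := by
      rintro rfl
      simp at hn
    obtain ⟨v, hav, hd⟩ := M.graph.exists_neighbor hne
    have hb1 := IsConnectedModular.btw_of_adj hav hd
    have hmv : m ≤ v := (M.le_iff _ _).2 (M.height.convex_up M.graph m b ((M.le_iff _ _).1 hb) b'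
      ((M.le_iff _ _).1 hb') v hb1)
    obtain ⟨w1, u1, h1⟩ := exists_isJoinFamily M N ha hmv
    have i1 := ih hmv h1 (by omega)
    have i2 := familyDist_triangle M N w w1 w' u u1 u'
    have i3 : familyDist δ N w w1 u u1 ≤ N * δ b v + D := by
      rcases M.height.below_or_of_adj hav with hl | hl <;> rw [← M.le_iff] at hl
      · linarith [h.familyDist_up_right M hN hav hl h1, hD a b]
      · rw [familyDist_symm M, M.metric.symm]
        linarith [h1.familyDist_up_right M hN hav.symm hl h, hD a v]
    rw [M.metric.btw _ _ _ hb1]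
    push_cast
    linarith

end IsJoinFamily

end ModularGraph

namespace ModularGraph

/-! ### The joint inequality for two pairs -/

variable {V : Type*} {Γ : SimpleGraph V}
variable [PartialOrder V] {g δ : V → V → ℝ} {ψ φ : V → ℝ} {θ : ℝ}

/-- Two convex sets. -/
structure ConvexPair (Γ : SimpleGraph V) (S S' : Set V) : Prop where
  left : IsGeodesicallyConvex Γ S
  right : IsGeodesicallyConvex Γ S'

namespace MutualGates

variable {S S' : Set V} {a a' b b' w w' x y : V}

theorem le_iff_le (M : IsOrderedModular Γ g δ ψ φ) (hS : ConvexPair Γ S S')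
    (ha : MutualGates Γ S S' a a') (hb : MutualGates Γ S S' b b') : a' ≤ b' ↔ a ≤ b := by
  rw [M.le_iff, M.le_iff]
  exact ha.below_iff M.height M.graph hS.left hS.right hb

theorem phi_sub_eq (M : IsOrderedModular Γ g δ ψ φ) (hS : ConvexPair Γ S S')
    (ha : MutualGates Γ S S' a a') (hb : MutualGates Γ S S' b b') :
    φ b' - φ a' = φ b - φ a := by
  refine potential_sub_eq (f := fun u v => g u v * (ψ v - ψ u)) M.graph hS.left hS.right ?_
    M.weighted ha hb
  intro u v v' u' h
  simp only
  rw [M.square _ _ _ _ h, M.height.square _ _ _ _ h]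

/-- Only the common upper bound is not immediate. It can be taken to be the join, which lies between
`x` and `y` and so is translated with them. -/
theorem exists_isCompat (M : IsOrderedModular Γ g δ ψ φ) (hS : ConvexPair Γ S S')
    (hw : MutualGates Γ S S' w w') (ha : MutualGates Γ S S' a a')
    (hb : MutualGates Γ S S' b b') (h : IsCompat w a b x y) :
    ∃ x' y', MutualGates Γ S S' x x' ∧ MutualGates Γ S S' y y' ∧ IsCompat w' a' b' x' y' := by
  obtain ⟨x', hx, -⟩ := exists_translate M.graph hS.left hS.right hw ha
    (M.btw_of_le h.left h.le_left)
  obtain ⟨y', hy, -⟩ := exists_translate M.graph hS.left hS.right hw hb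
    (M.btw_of_le h.right h.le_right)
  obtain ⟨v, hv1, hv2⟩ := h.bdd
  obtain ⟨u, hu, hu'⟩ := M.exists_isLUB hv1 hv2
  obtain ⟨u', hu'', -⟩ := exists_translate M.graph hS.left hS.right hx hy hu'
  exact ⟨x', y', hx, hy, (le_iff_le M hS hw hx).2 h.left, (le_iff_le M hS hx ha).2 h.le_left,
    (le_iff_le M hS hw hy).2 h.right, (le_iff_le M hS hy hb).2 h.le_right, u',
    (le_iff_le M hS hx hu'').2 (hu.1 (by simp)), (le_iff_le M hS hy hu'').2 (hu.1 (by simp))⟩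

theorem exists_isSelected (M : IsOrderedModular Γ g δ ψ φ) (hS : ConvexPair Γ S S')
    (hw : MutualGates Γ S S' w w') (ha : MutualGates Γ S S' a a')
    (hb : MutualGates Γ S S' b b') (h : IsSelected φ θ w a b x y) :
    ∃ x' y', MutualGates Γ S S' x x' ∧ MutualGates Γ S S' y y' ∧
      IsSelected φ θ w' a' b' x' y' := by
  obtain ⟨x', y', hx, hy, hc⟩ := exists_isCompat M hS hw ha hb h.compat
  refine ⟨x', y', hx, hy, hc, ?_, ?_⟩
  all_goals
    intro p' q' hpq
    obtain ⟨p, q, hp, hq, hpq'⟩ :=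
      exists_isCompat M ⟨hS.right, hS.left⟩ hw.symm ha.symm hb.symm hpq
    have e1 := phi_sub_eq M hS hx hp.symm
    have e2 := phi_sub_eq M hS hy hq.symm
    have e3 : θ * φ p' + (1 - θ) * φ q' - (θ * φ x' + (1 - θ) * φ y') =
        θ * φ p + (1 - θ) * φ q - (θ * φ x + (1 - θ) * φ y) := by
      linear_combination θ * e1 + (1 - θ) * e2
  · linarith [h.le _ _ hpq']
  · intro he
    exact (le_iff_le M hS hp.symm hx).2 (h.tie _ _ hpq' (by linarith))

/-- Translation carries one whole construction to the other, so the meets and all joins are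
displaced by the same `δ a a' = δ b b'`. There are `N` copies of the meet and fewer than `N` joins.
-/
theorem familyDist_le (M : IsOrderedModular Γ g δ ψ φ) (hS : ConvexPair Γ S S')
    (ha : MutualGates Γ S S' a a') (hb : MutualGates Γ S S' b b') {N : ℕ} {u u' : ℕ → V}
    (h : IsJoinFamily φ N a b w u) (h' : IsJoinFamily φ N a' b' w' u') :
    familyDist δ N w w' u u' ≤ N * (δ a a' + δ b b') := by
  obtain ⟨w'', hw, hw'⟩ := exists_translate M.graph hS.left hS.right ha hb (M.btw_of_isGLB h.glb)
  have hglb : IsGLB {a', b'} w'' := M.isGLB_of_btw hw'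
    ((le_iff_le M hS hw ha).2 (h.glb.1 (by simp))) ((le_iff_le M hS hw hb).2 (h.glb.1 (by simp)))
  obtain rfl := hglb.unique h'.glb
  have hδ : ∀ {c c'}, MutualGates Γ S S' c c' → δ c c' = δ a a' := fun hc =>
    metric_eq M.graph hS.left hS.right M.square M.metric ha hc
  have h1 : ∀ k ∈ Finset.Ioo 0 N, δ (u k) (u' k) ≤ δ a a' := by
    intro k hk
    rw [Finset.mem_Ioo] at hk
    obtain ⟨x, y, hs, hu⟩ := h.sel k hk.1 hk.2
    obtain ⟨x₁, y₁, hs₁, hu₁⟩ := h'.sel k hk.1 hk.2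
    obtain ⟨x', y', hx, hy, hs'⟩ := exists_isSelected M hS hw ha hb hs
    obtain ⟨rfl, rfl⟩ := hs'.unique M (param_lt_one hk.2) hs₁
    obtain ⟨v, hv, hv'⟩ := exists_translate M.graph hS.left hS.right hx hy (M.btw_of_isLUB hu)
    have : IsLUB {x', y'} v := M.isLUB_of_btw hv'
      ((le_iff_le M hS hx hv).2 (hu.1 (by simp))) ((le_iff_le M hS hy hv).2 (hu.1 (by simp)))
    obtain rfl := this.unique hu₁
    rw [hδ hv]
  have h2 := Finset.sum_le_sum h1
  rw [Finset.sum_const, Nat.card_Ioo, nsmul_eq_mul] at h2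
  have h3 : ((N - 0 - 1 : ℕ) : ℝ) ≤ N := by exact_mod_cast (by omega)
  have h4 := mul_le_mul_of_nonneg_right h3 (M.metric.nonneg a a')
  rw [familyDist, hδ hw, hδ hb]
  linarith

end MutualGates

/-- The joint inequality for the greatest lower bounds and the joins of two pairs. -/
theorem IsJoinFamily.familyDist_le [Finite V] (M : IsOrderedModular Γ g δ ψ φ) {D : ℝ} {L : ℕ}
    (hD : ∀ a b, δ a b ≤ D) (hL : ∀ a b, Γ.dist a b ≤ L) {N : ℕ} (hN : 0 < N)
    {m m' a b a' b' w w' : V} {u u' : ℕ → V} (ha : m ≤ a) (hb : m ≤ b) (ha' : m' ≤ a')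
    (hb' : m' ≤ b') (h : IsJoinFamily φ N a b w u) (h' : IsJoinFamily φ N a' b' w' u') :
    familyDist δ N w w' u u' ≤ N * (δ a a' + δ b b') + 4 * L * D := by
  have hS : ConvexPair Γ {x | Below Γ ψ m x} {x | Below Γ ψ m' x} :=
    ⟨M.height.convex_up M.graph m, M.height.convex_up M.graph m'⟩
  have key : ∀ {c c' : V}, m ≤ c → m' ≤ c' → ∃ d d', m ≤ d ∧ m' ≤ d' ∧
      MutualGates Γ {x | Below Γ ψ m x} {x | Below Γ ψ m' x} d d' ∧
      δ c c' = δ c d + δ d d' + δ d' c' := by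
    intro c c' hc hc'
    rw [M.le_iff] at hc hc'
    obtain ⟨d, d', h1, h2, h3⟩ := M.graph.exists_mutualGates hS.left ⟨c, hc⟩ hS.right hc'
    refine ⟨d, d', (M.le_iff _ _).2 h1.mem, (M.le_iff _ _).2 h1.mem', h1, ?_⟩
    have e1 := M.metric.btw _ _ _ (h2 c hc)
    have e2 := M.metric.btw _ _ _ h3
    rw [M.metric.symm c c', M.metric.symm c d, M.metric.symm d d', M.metric.symm d' c']
    linarith
  -- Move `a`, then `b`, to their gates above `m`; cross over to the gates above `m'`; then move to
  -- `a'` and `b'`. The crossing has no error and each of the four moves costs at most `L * D`.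
  obtain ⟨a₁, a₂, ha₁, ha₂, hga, hda⟩ := key ha ha'
  obtain ⟨b₁, b₂, hb₁, hb₂, hgb, hdb⟩ := key hb hb'
  obtain ⟨w₁, u₁, h₁⟩ := exists_isJoinFamily M N ha₁ hb
  obtain ⟨w₂, u₂, h₂⟩ := exists_isJoinFamily M N ha₁ hb₁
  obtain ⟨w₃, u₃, h₃⟩ := exists_isJoinFamily M N ha₂ hb₂
  obtain ⟨w₄, u₄, h₄⟩ := exists_isJoinFamily M N ha' hb₂
  have i1 := h.familyDist_left M hD hN ha ha₁ hb h₁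
  have i2 := h₁.familyDist_right M hD hN ha₁ hb hb₁ h₂
  have i3 := MutualGates.familyDist_le M hS hga hgb h₂ h₃
  have i4 := h₃.familyDist_left M hD hN ha₂ ha' hb₂ h₄
  have i5 := h₄.familyDist_right M hD hN ha' hb₂ hb' h'
  have t1 := familyDist_triangle M N w w₁ w' u u₁ u'
  have t2 := familyDist_triangle M N w₁ w₂ w' u₁ u₂ u'
  have t3 := familyDist_triangle M N w₂ w₃ w' u₂ u₃ u'
  have t4 := familyDist_triangle M N w₃ w₄ w' u₃ u₄ u'
  have hD0 : 0 ≤ D := by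
    have := hD a a
    rwa [M.metric.self] at this
  have hLD : ∀ p q, (Γ.dist p q : ℝ) * D ≤ L * D := fun p q =>
    mul_le_mul_of_nonneg_right (by exact_mod_cast hL p q) hD0
  rw [hda, hdb]
  have l1 := hLD a a₁
  have l2 := hLD b b₁
  have l3 := hLD a₂ a'
  have l4 := hLD b₂ b'
  linarith

end ModularGraph

namespace ModularGraph

/-! ### Location functions and the joint inequality for them -/

variable {V : Type*} {Γ : SimpleGraph V}

/-- The part of a location problem that is linear in the distances of the pairs. -/
noncomputable def pairSum [Fintype V] {n : ℕ} (c : Sym2 (V ⊕ Fin n) → ℚ)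
    (f : V ⊕ Fin n → V ⊕ Fin n → ℝ) : ℝ :=
  (∑ s : V, ∑ j : Fin n, (c s(Sum.inl s, Sum.inr j) : ℝ) * f (Sum.inl s) (Sum.inr j)) +
  ∑ i : Fin n, ∑ j ∈ Finset.Ioi i,
    (c s(Sum.inr i, Sum.inr j) : ℝ) * f (Sum.inr i) (Sum.inr j)

section pairSum

variable [Fintype V] {n : ℕ} {c : Sym2 (V ⊕ Fin n) → ℚ}

theorem pairSum_add (f f' : V ⊕ Fin n → V ⊕ Fin n → ℝ) :
    pairSum c (fun p q => f p q + f' p q) = pairSum c f + pairSum c f' := by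
  simp only [pairSum, mul_add, Finset.sum_add_distrib]
  ring

theorem pairSum_mul (r : ℝ) (f : V ⊕ Fin n → V ⊕ Fin n → ℝ) :
    pairSum c (fun p q => r * f p q) = r * pairSum c f := by
  simp only [pairSum, mul_left_comm _ r, ← Finset.mul_sum]
  ring

theorem pairSum_zero : pairSum c (fun _ _ => 0) = 0 := by
  simp [pairSum]

theorem pairSum_sum {ι : Type*} (t : Finset ι) (f : ι → V ⊕ Fin n → V ⊕ Fin n → ℝ) :
    pairSum c (fun p q => ∑ k ∈ t, f k p q) = ∑ k ∈ t, pairSum c (f k) := by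
  classical
  induction t using Finset.induction_on with
  | empty => simp [pairSum_zero]
  | insert k t hk ih =>
    simp only [Finset.sum_insert hk]
    rw [pairSum_add, ih]

theorem pairSum_mono (hc : ∀ e : Sym2 (V ⊕ Fin n), ¬ e.IsDiag → 0 ≤ c e)
    {f f' : V ⊕ Fin n → V ⊕ Fin n → ℝ} (h : ∀ p q, f p q ≤ f' p q) :
    pairSum c f ≤ pairSum c f' := by
  refine add_le_add (Finset.sum_le_sum fun s _ => Finset.sum_le_sum fun j _ => ?_)
    (Finset.sum_le_sum fun i _ => Finset.sum_le_sum fun j hj => ?_)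
  · exact mul_le_mul_of_nonneg_left (h _ _) (by exact_mod_cast hc _ (by simp))
  · have : i ≠ j := (Finset.mem_Ioi.1 hj).ne
    exact mul_le_mul_of_nonneg_left (h _ _) (by exact_mod_cast hc _ (by simpa using this))

end pairSum

/-- The location function for the metric `δ`. -/
noncomputable def metricCost [Fintype V] {n : ℕ} (c : Sym2 (V ⊕ Fin n) → ℚ) (δ : V → V → ℝ)
    (ρ : Fin n → V) : ℝ :=
  pairSum c fun p q => δ (Sum.elim id ρ p) (Sum.elim id ρ q)

theorem locationCost_eq [Fintype V] {n : ℕ} (c : Sym2 (V ⊕ Fin n) → ℚ) (h : Γ.edgeSet → ℝ)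
    (ρ : Fin n → V) : locationCost Γ h c ρ = metricCost c (weightedDist Γ h) ρ := rfl

/-- A set of locations closed under moving coordinates along shortest paths. -/
def IsBoxConvex (Γ : SimpleGraph V) {n : ℕ} (B : Set (Fin n → V)) : Prop :=
  ∀ a ∈ B, ∀ b ∈ B, ∀ x : Fin n → V, (∀ i, Btw Γ (a i) (x i) (b i)) → x ∈ B

/-- Comparability in the product order. -/
def Comparable (Γ : SimpleGraph V) (ψ : V → ℝ) {n : ℕ} (a b : Fin n → V) : Prop :=
  (∀ i, Below Γ ψ (a i) (b i)) ∨ ∀ i, Below Γ ψ (b i) (a i)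

theorem comparable_neg {ψ : V → ℝ} {n : ℕ} {a b : Fin n → V} :
    Comparable Γ (-ψ) a b ↔ Comparable Γ ψ a b := by
  simp only [Comparable, below_neg]
  exact or_comm

/-- A step between comparable locations in `B` of value less than `α`. -/
structure IsStep (Γ : SimpleGraph V) (ψ : V → ℝ) {n : ℕ} (B : Set (Fin n → V))
    (F : (Fin n → V) → ℝ) (α : ℝ) (a b : Fin n → V) : Prop where
  mem : a ∈ B
  mem' : b ∈ B
  lt : F a < α
  lt' : F b < α
  comp : Comparable Γ ψ a b

theorem isStep_neg {ψ : V → ℝ} {n : ℕ} {B : Set (Fin n → V)} {F : (Fin n → V) → ℝ} {α : ℝ} :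
    IsStep Γ (-ψ) B F α = IsStep Γ ψ B F α := by
  funext a b
  refine propext ⟨fun h => ⟨h.1, h.2, h.3, h.4, comparable_neg.1 h.5⟩,
    fun h => ⟨h.1, h.2, h.3, h.4, comparable_neg.2 h.5⟩⟩

section

variable [PartialOrder V] {g δ : V → V → ℝ} {ψ φ : V → ℝ} {n : ℕ}

/-- This lets the fixed vertices of `Γ` enter the joint inequality on the same footing as the free
coordinates. -/
theorem isJoinFamily_self (N : ℕ) (s : V) : IsJoinFamily φ N s s s fun _ => s := by
  refine ⟨by simp, fun k _ _ => ⟨s, s,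
    ⟨⟨le_rfl, le_rfl, le_rfl, le_rfl, s, le_rfl, le_rfl⟩, ?_, ?_⟩, by simp⟩⟩
  · intro x y h
    rw [le_antisymm h.le_left h.left, le_antisymm h.le_right h.right]
  · intro x y h _
    exact h.le_left

/-- A selected pair whose join is `b` has a small parameter. -/
theorem IsJoinFamily.mul_le_of_eq_right (M : IsOrderedModular Γ g δ ψ φ) {N : ℕ} {a b w : V}
    {u : ℕ → V} (h : IsJoinFamily φ N a b w u) {k : ℕ} (h0 : 0 < k) (hN : k < N)
    (hk : u k = b) : k * ((φ a - φ w) + (φ b - φ w)) ≤ N * (φ b - φ w) := by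
  obtain ⟨x, y, hs, hu⟩ := h.sel k h0 hN
  have h1 := hs.isGLB_left M (param_pos h0 hN) hu
  rw [hk] at h1
  -- If the join is `b`, then `x` is the meet of `a` and `b`. The claim is optimality tested against
  -- the pair formed by `a` and that meet.
  obtain rfl := h1.unique h.glb
  have hxa : x ≤ a := h.glb.1 (by simp)
  have h2 := hs.le a x ⟨hxa, le_rfl, le_rfl, h.glb.1 (by simp), a, le_rfl, hxa⟩
  have h3 := M.monotone hs.compat.le_right
  have hN' : (0 : ℝ) < N := by exact_mod_cast h0.trans hN
  have h4 : (0 : ℝ) ≤ 1 - (k : ℝ) / N := sub_nonneg.2 (param_lt_one hN).le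
  have h5 := mul_le_mul_of_nonneg_left h3 h4
  have h6 := mul_le_mul_of_nonneg_left (h2.trans (add_le_add_right h5 _)) hN'.le
  have e : ∀ p q : ℝ, (N : ℝ) * ((k : ℝ) / N * p + (1 - (k : ℝ) / N) * q) =
      k * p + (N - k) * q := by
    intro p q
    field_simp
  rw [e, e] at h6
  linarith

variable [Fintype V] {c : Sym2 (V ⊕ Fin n) → ℚ}

/-- The joint inequality for the greatest lower bounds and the joins of two locations. -/
theorem IsOrderedModular.metricCost_le (M : IsOrderedModular Γ g δ ψ φ)
    (hc : ∀ e : Sym2 (V ⊕ Fin n), ¬ e.IsDiag → 0 ≤ c e) :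
    ∃ C : ℝ, ∀ N : ℕ, 0 < N → ∀ a b m w : Fin n → V, ∀ u : Fin n → ℕ → V, m ≤ a → m ≤ b →
      (∀ i, IsJoinFamily φ N (a i) (b i) (w i) (u i)) →
      N * metricCost c δ w + ∑ k ∈ Finset.Ioo 0 N, metricCost c δ (fun i => u i k) ≤
        N * (metricCost c δ a + metricCost c δ b) + C := by
  obtain ⟨D, hD⟩ : ∃ D : ℝ, ∀ a b : V, δ a b ≤ D := by
    obtain ⟨D, hD⟩ := (Set.finite_range fun p : V × V => δ p.1 p.2).bddAbove
    exact ⟨D, fun a b => hD ⟨(a, b), rfl⟩⟩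
  obtain ⟨L, hL⟩ : ∃ L : ℕ, ∀ a b : V, Γ.dist a b ≤ L := by
    obtain ⟨D, hD⟩ := (Set.finite_range fun p : V × V => Γ.dist p.1 p.2).bddAbove
    exact ⟨D, fun a b => hD ⟨(a, b), rfl⟩⟩
  refine ⟨pairSum c fun _ _ => 4 * L * D, fun N hN a b m w u hma hmb hu => ?_⟩
  have hu' : ∀ p : V ⊕ Fin n, IsJoinFamily φ N (Sum.elim id a p) (Sum.elim id b p)
      (Sum.elim id w p) (Sum.elim (fun s _ => s) u p) := by
    rintro (s | i)
    exacts [isJoinFamily_self N s, hu i]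
  have hm : ∀ p : V ⊕ Fin n, Sum.elim id m p ≤ Sum.elim id a p ∧
      Sum.elim id m p ≤ Sum.elim id b p := by
    rintro (s | i)
    exacts [⟨le_rfl, le_rfl⟩, ⟨hma i, hmb i⟩]
  have e1 : ∀ k (p : V ⊕ Fin n), Sum.elim id (fun i => u i k) p =
      Sum.elim (fun s _ => s) u p k := by
    rintro k (s | i) <;> rfl
  have key := pairSum_mono hc fun p q => IsJoinFamily.familyDist_le M hD hL hN
    (hm p).1 (hm p).2 (hm q).1 (hm q).2 (hu' p) (hu' q)
  simp only [familyDist] at key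
  rw [pairSum_add, pairSum_add, pairSum_mul, pairSum_mul, pairSum_add, pairSum_sum] at key
  simpa only [metricCost, e1] using key

theorem card_filter_mul_le {N : ℕ} {r q : ℝ} (hr : 0 < r) (hq : 0 ≤ q) :
    (((Finset.Ioo 0 N).filter fun k : ℕ => (k : ℝ) * r ≤ q).card : ℝ) * r ≤ q := by
  have h1 : (Finset.Ioo 0 N).filter (fun k : ℕ => (k : ℝ) * r ≤ q) ⊆ Finset.Ioc 0 ⌊q / r⌋₊ := by
    intro k hk
    rw [Finset.mem_filter, Finset.mem_Ioo] at hk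
    rw [Finset.mem_Ioc]
    exact ⟨hk.1.1, Nat.le_floor ((le_div_iff₀ hr).2 hk.2)⟩
  have h2 := Finset.card_le_card h1
  rw [Nat.card_Ioc, Nat.sub_zero] at h2
  rw [← le_div_iff₀ hr]
  exact le_trans (by exact_mod_cast h2) (Nat.floor_le (div_nonneg hq hr.le))

/-- Some join of two locations with a common lower bound has a small value. -/
theorem IsOrderedModular.exists_join_lt (M : IsOrderedModular Γ g δ ψ φ)
    (hc : ∀ e : Sym2 (V ⊕ Fin n), ¬ e.IsDiag → 0 ≤ c e) {α : ℝ} {a b m w : Fin n → V}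
    (ha : m ≤ a) (hb : m ≤ b) (hw : ∀ i, IsGLB {a i, b i} (w i)) (hab : ¬ a ≤ b)
    (hFa : metricCost c δ a ≤ α) (hFb : metricCost c δ b < α) (hFw : α ≤ metricCost c δ w) :
    ∃ u : Fin n → V, (∀ i, Btw Γ (a i) (u i) (b i)) ∧ u ≠ a ∧ u ≠ b ∧ metricCost c δ u < α := by
  obtain ⟨C, hC⟩ := M.metricCost_le hc
  obtain ⟨i, hi⟩ : ∃ i, ¬ a i ≤ b i := by
    by_contra h
    push Not at h
    exact hab h
  set F := metricCost c δ
  set p := φ (a i) - φ (w i)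
  set q := φ (b i) - φ (w i)
  have hwa : w i ≤ a i := (hw i).1 (by simp)
  have hp : 0 < p := sub_pos.2 (M.strictMono (lt_of_le_of_ne hwa fun h =>
    hi (h ▸ (hw i).1 (by simp))))
  have hq : 0 ≤ q := sub_nonneg.2 (M.monotone ((hw i).1 (by simp)))
  -- For such `N` the error `C` is too small to close the gap `α - F b` at the parameters whose join
  -- cannot be `b`.
  obtain ⟨N₀, hN₀⟩ := exists_nat_gt ((C + F a) * (p + q) / (p * (α - F b)))
  have hpos : 0 < p * (α - F b) := mul_pos hp (by linarith)
  obtain ⟨N, hN, hN0⟩ : ∃ N : ℕ, (C + F a) * (p + q) < N * (p * (α - F b)) ∧ 0 < N := by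
    refine ⟨N₀ + 1, ?_, Nat.succ_pos _⟩
    rw [div_lt_iff₀ hpos] at hN₀
    push_cast
    linarith
  have hfam : ∀ j, ∃ u, IsJoinFamily φ N (a j) (b j) (w j) u := by
    intro j
    obtain ⟨w', u, h⟩ := exists_isJoinFamily (φ := φ) M N (ha j) (hb j)
    rw [h.glb.unique (hw j)] at h
    exact ⟨u, h⟩
  choose u hu using hfam
  by_contra hcon
  -- If no join is as wanted, each one costs at least `F a`, except those equal to `b`, which occur
  -- only for `k (p + q) ≤ N q`. As `p > 0`, that leaves a positive fraction of the parameters.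
  have hbig : ∀ k ∈ Finset.Ioo 0 N,
      F a - (if (k : ℝ) * (p + q) ≤ N * q then α - F b else 0) ≤ F fun j => u j k := by
    intro k hk
    rw [Finset.mem_Ioo] at hk
    have h3 : (0 : ℝ) ≤ if (k : ℝ) * (p + q) ≤ N * q then α - F b else 0 := by
      split_ifs <;> linarith
    by_cases h1 : (fun j => u j k) = a
    · rw [h1]
      linarith
    by_cases h2 : (fun j => u j k) = b
    · rw [h2, if_pos ((hu i).mul_le_of_eq_right M hk.1 hk.2 (congrFun h2 i))]
      linarith
    · have : α ≤ F fun j => u j k := by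
        by_contra hlt
        exact hcon ⟨_, fun j => (hu j).btw M hk.1 hk.2, h1, h2, not_le.1 hlt⟩
      linarith
  have h1 := Finset.sum_le_sum hbig
  have h2 := hC N hN0 a b m w u ha hb hu
  rw [Finset.sum_sub_distrib, Finset.sum_const, ← Finset.sum_filter, Finset.sum_const,
    Nat.card_Ioo, nsmul_eq_mul, nsmul_eq_mul] at h1
  have h3 : ((N - 0 - 1 : ℕ) : ℝ) = N - 1 := by
    rw [Nat.sub_zero, Nat.cast_sub hN0]
    simp
  rw [h3] at h1
  have h4 := card_filter_mul_le (N := N) (r := p + q) (q := N * q) (by linarith) (by positivity)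
  set K : ℝ := (((Finset.Ioo 0 N).filter fun k : ℕ => (k : ℝ) * (p + q) ≤ N * q).card : ℝ)
  have h5 : (N : ℝ) * α ≤ N * F w := mul_le_mul_of_nonneg_left hFw (Nat.cast_nonneg N)
  have h6 : N * (α - F b) - F a - C ≤ K * (α - F b) := by linarith
  have h7 := mul_le_mul_of_nonneg_right h6 (by linarith : 0 ≤ p + q)
  have h8 := mul_le_mul_of_nonneg_right h4 (by linarith : 0 ≤ α - F b)
  linarith

/-- Connecting two locations with a common lower bound through comparable locations. -/
theorem IsOrderedModular.exists_comparable (M : IsOrderedModular Γ g δ ψ φ)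
    (hc : ∀ e : Sym2 (V ⊕ Fin n), ¬ e.IsDiag → 0 ≤ c e) {B : Set (Fin n → V)}
    (hB : IsBoxConvex Γ B) {α : ℝ} {m : Fin n → V} (a b : Fin n → V) (ha : m ≤ a) (hb : m ≤ b)
    (haB : a ∈ B) (hbB : b ∈ B) (hFa : metricCost c δ a ≤ α) (hFb : metricCost c δ b < α) :
    ∃ x ∈ B, metricCost c δ x < α ∧ Comparable Γ ψ a x ∧
      Relation.ReflTransGen (IsStep Γ ψ B (metricCost c δ) α) x b := by
  induction hs : ∑ i, Γ.dist (a i) (b i) using Nat.strong_induction_on generalizing a b with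
  | _ s ih =>
    subst hs
    by_cases hab : a ≤ b
    · exact ⟨b, hbB, hFb, Or.inl fun i => (M.le_iff _ _).1 (hab i), .refl⟩
    have hw : ∀ i, ∃ w, IsGLB {a i, b i} w ∧ Btw Γ (a i) w (b i) :=
      fun i => M.exists_isGLB (ha i) (hb i)
    choose w hw hwb using hw
    rcases lt_or_ge (metricCost c δ w) α with hFw | hFw
    · have hwB := hB a haB b hbB w hwb
      exact ⟨w, hwB, hFw, Or.inr fun i => (M.le_iff _ _).1 ((hw i).1 (by simp)),
        .single ⟨hwB, hbB, hFw, hFb, Or.inl fun i => (M.le_iff _ _).1 ((hw i).1 (by simp))⟩⟩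
    obtain ⟨u, hu, hua, hub, hFu⟩ := M.exists_join_lt hc ha hb hw hab hFa hFb hFw
    have huB := hB a haB b hbB u hu
    have hmu : m ≤ u := fun i => (M.le_iff _ _).2 (M.height.convex_up M.graph _ _
      ((M.le_iff _ _).1 (ha i)) _ ((M.le_iff _ _).1 (hb i)) _ (hu i))
    have hsum : ∑ i, Γ.dist (a i) (b i) =
        ∑ i, Γ.dist (a i) (u i) + ∑ i, Γ.dist (u i) (b i) := by
      rw [← Finset.sum_add_distrib]
      exact Finset.sum_congr rfl fun i _ => hu i
    have hpos : ∀ {x y : Fin n → V}, x ≠ y → 0 < ∑ i, Γ.dist (x i) (y i) := by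
      intro x y hxy
      obtain ⟨i, hi⟩ := Function.ne_iff.1 hxy
      refine Finset.sum_pos' (fun _ _ => Nat.zero_le _) ⟨i, Finset.mem_univ _, ?_⟩
      exact Nat.pos_of_ne_zero fun h => hi (M.graph.eq_of_dist h)
    obtain ⟨x, hx, hFx, hax, hxu⟩ := ih _ (by have := hpos hub; omega) a u ha hmu haB huB hFa hFu
      rfl
    obtain ⟨y, hy, hFy, huy, hyb⟩ := ih _ (by have := hpos hua.symm; omega) u b hmu hb huB hbB
      hFu.le hFb rfl
    exact ⟨x, hx, hFx, hax, (hxu.tail ⟨huB, hy, hFu, hFy, huy⟩).trans hyb⟩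

end

end ModularGraph

namespace ModularGraph

/-! ### Sublevel sets are connected by comparable steps -/

variable {V : Type*} {Γ : SimpleGraph V}

/-- A connected modular graph with a metric given by positive square-invariant edge weights. -/
structure IsPositiveMetric (Γ : SimpleGraph V) (g δ : V → V → ℝ) : Prop where
  graph : IsConnectedModular Γ
  square : SquareInvariant Γ g
  symm : ∀ u v, g u v = g v u
  pos : ∀ u v, Γ.Adj u v → 0 < g u v
  metric : IsGeodesicMetric Γ g δ

theorem exists_level {ι : Type*} [Finite ι] (F : ι → ℝ) (v : ℝ) :
    ∃ β, v < β ∧ ∀ x, F x < β → F x ≤ v := by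
  rcases Set.eq_empty_or_nonempty {x | v < F x} with h | h
  · exact ⟨v + 1, by linarith, fun x _ => not_lt.1 fun hx => (h ▸ hx : x ∈ (∅ : Set ι)).elim⟩
  · obtain ⟨y, hy, hmin⟩ := Set.exists_min_image _ F (Set.toFinite _) h
    exact ⟨F y, hy, fun x hx => not_lt.1 fun hvx => absurd hx (not_lt.2 (hmin x hvx))⟩

/-- The starting level, where the value imposes no restriction: change one coordinate along one edge
at a time, which always gives comparable locations. -/
theorem IsConnectedModular.exists_steps (hΓ : IsConnectedModular Γ) {ψ : V → ℝ}
    (hψ : IsHeight Γ ψ) {n : ℕ} {B : Set (Fin n → V)} (hB : IsBoxConvex Γ B) {α : ℝ}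
    {F : (Fin n → V) → ℝ} (hF : ∀ x, F x < α) (a b : Fin n → V)
    (ha : a ∈ B) (hb : b ∈ B) : Relation.ReflTransGen (IsStep Γ ψ B F α) a b := by
  classical
  induction hs : ∑ i, Γ.dist (a i) (b i) using Nat.strong_induction_on generalizing a with
  | _ s ih =>
    subst hs
    by_cases hab : a = b
    · rw [hab]
    obtain ⟨i, hi⟩ := Function.ne_iff.1 hab
    obtain ⟨v, hav, hd⟩ := hΓ.exists_neighbor hi
    have hbtw : ∀ j, Btw Γ (a j) (Function.update a i v j) (b j) := by
      intro j
      by_cases hj : j = i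
      · subst hj
        rw [Function.update_self]
        exact IsConnectedModular.btw_of_adj hav hd
      · rw [Function.update_of_ne hj]
        exact btw_left _ _
    have hmem := hB a ha b hb _ hbtw
    have hlt : ∑ j, Γ.dist (Function.update a i v j) (b j) < ∑ j, Γ.dist (a j) (b j) := by
      refine Finset.sum_lt_sum (fun j _ => ?_) ⟨i, Finset.mem_univ _, ?_⟩
      · have := hbtw j
        unfold Btw at this
        omega
      · rw [Function.update_self]
        omega
    refine Relation.ReflTransGen.head ⟨ha, hmem, hF _, hF _, ?_⟩ (ih _ hlt _ hmem rfl)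
    have hup : ∀ {ψ : V → ℝ}, Below Γ ψ (a i) v →
        ∀ j, Below Γ ψ (a j) (Function.update a i v j) := by
      intro ψ h j
      by_cases hj : j = i
      · subst hj
        rwa [Function.update_self]
      · rw [Function.update_of_ne hj]
        exact below_refl _ _
    rcases hψ.below_or_of_adj hav with h | h
    · exact Or.inl (hup h)
    · exact Or.inr fun j => below_neg.1 (hup (below_neg.2 h) j)

section

variable [Fintype V] {g δ : V → V → ℝ} {ψ : V → ℝ} {n : ℕ} {c : Sym2 (V ⊕ Fin n) → ℚ}
  {B : Set (Fin n → V)} {α : ℝ}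

theorem IsPositiveMetric.exists_comparable_up (P : IsPositiveMetric Γ g δ) (hψ : IsHeight Γ ψ)
    (hc : ∀ e : Sym2 (V ⊕ Fin n), ¬ e.IsDiag → 0 ≤ c e) (hB : IsBoxConvex Γ B)
    {m a b : Fin n → V} (ha : ∀ i, Below Γ ψ (m i) (a i)) (hb : ∀ i, Below Γ ψ (m i) (b i))
    (haB : a ∈ B) (hbB : b ∈ B) (hFa : metricCost c δ a ≤ α) (hFb : metricCost c δ b < α) :
    ∃ x ∈ B, metricCost c δ x < α ∧ Comparable Γ ψ a x ∧
      Relation.ReflTransGen (IsStep Γ ψ B (metricCost c δ) α) x b := by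
  let _ := hψ.toPartialOrder P.graph
  obtain ⟨φ, hφ⟩ := hψ.exists_weightedHeight P.graph P.square P.symm
  have M : IsOrderedModular Γ g δ ψ φ :=
    ⟨P.graph, hψ, P.square, P.pos, P.metric, hφ, fun _ _ => Iff.rfl⟩
  exact M.exists_comparable hc hB a b ha hb haB hbB hFa hFb

/-- Two comparabilities through `m` either compose or make `m` a common bound; a common upper bound
is turned into a lower one by negating the height. The value at `m` plays no role. -/
theorem IsPositiveMetric.exists_comparable (P : IsPositiveMetric Γ g δ) (hψ : IsHeight Γ ψ)
    (hc : ∀ e : Sym2 (V ⊕ Fin n), ¬ e.IsDiag → 0 ≤ c e) (hB : IsBoxConvex Γ B)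
    {m a b : Fin n → V} (ha : Comparable Γ ψ a m) (hb : Comparable Γ ψ m b)
    (haB : a ∈ B) (hbB : b ∈ B) (hFa : metricCost c δ a ≤ α) (hFb : metricCost c δ b < α) :
    ∃ x ∈ B, metricCost c δ x < α ∧ Comparable Γ ψ a x ∧
      Relation.ReflTransGen (IsStep Γ ψ B (metricCost c δ) α) x b := by
  rcases ha with ha | ha <;> rcases hb with hb | hb
  · exact ⟨b, hbB, hFb, Or.inl fun i => (hψ.below_trans P.graph (ha i) (hb i)).1, .refl⟩
  · obtain ⟨x, hx, hFx, hax, hxb⟩ := P.exists_comparable_up hψ.neg hc hB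
      (fun i => below_neg.2 (ha i)) (fun i => below_neg.2 (hb i)) haB hbB hFa hFb
    rw [isStep_neg] at hxb
    exact ⟨x, hx, hFx, comparable_neg.1 hax, hxb⟩
  · exact P.exists_comparable_up hψ hc hB ha hb haB hbB hFa hFb
  · exact ⟨b, hbB, hFb, Or.inr fun i => (hψ.below_trans P.graph (hb i) (ha i)).1, .refl⟩

/-- A chain of locations of value at most `α` can be improved to value less than `α`. -/
theorem IsPositiveMetric.improve (P : IsPositiveMetric Γ g δ) (hψ : IsHeight Γ ψ)
    (hc : ∀ e : Sym2 (V ⊕ Fin n), ¬ e.IsDiag → 0 ≤ c e) (hB : IsBoxConvex Γ B) {β : ℝ}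
    (hβ : ∀ x, metricCost c δ x < β → metricCost c δ x ≤ α) {a b : Fin n → V} (hbB : b ∈ B)
    (hFb : metricCost c δ b < α)
    (h : Relation.ReflTransGen (IsStep Γ ψ B (metricCost c δ) β) a b) :
    ∃ x ∈ B, metricCost c δ x < α ∧ Comparable Γ ψ a x ∧
      Relation.ReflTransGen (IsStep Γ ψ B (metricCost c δ) α) x b := by
  induction h using Relation.ReflTransGen.head_induction_on with
  | refl => exact ⟨b, hbB, hFb, Or.inl fun i => below_refl _ _, .refl⟩
  | head hay _ ih =>
    obtain ⟨x, hx, hFx, hyx, hxb⟩ := ih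
    obtain ⟨z, hz, hFz, haz, hzx⟩ := P.exists_comparable hψ hc hB hay.comp hyx hay.mem hx
      (hβ _ hay.lt) hFx
    exact ⟨z, hz, hFz, haz, hzx.trans hxb⟩

/-- The sublevel sets in a box are connected by comparable steps. -/
theorem IsPositiveMetric.exists_steps (P : IsPositiveMetric Γ g δ) (hψ : IsHeight Γ ψ)
    (hc : ∀ e : Sym2 (V ⊕ Fin n), ¬ e.IsDiag → 0 ≤ c e) (hB : IsBoxConvex Γ B)
    (α : ℝ) (a b : Fin n → V) (ha : a ∈ B) (hb : b ∈ B) (hFa : metricCost c δ a < α)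
    (hFb : metricCost c δ b < α) :
    Relation.ReflTransGen (IsStep Γ ψ B (metricCost c δ) α) a b := by
  classical
  induction hs : (Finset.univ.filter fun x : Fin n → V => α ≤ metricCost c δ x).card
    using Nat.strong_induction_on generalizing α a b with
  | _ s ih =>
    subst hs
    by_cases hex : ∃ x : Fin n → V, α ≤ metricCost c δ x
    -- Lower the level one value at a time. With `y` the cheapest location not below `α`, a chain at
    -- the next higher level `β` has values at most that of `y`; improving it brings all values
    -- below that of `y`, hence below `α`.
    · obtain ⟨y, hy, hmin⟩ := Set.exists_min_image {x : Fin n → V | α ≤ metricCost c δ x}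
        (metricCost c δ) (Set.toFinite _) hex
      obtain ⟨β, hβ, hβ'⟩ := exists_level (metricCost (V := V) c δ) (metricCost c δ y)
      have hcard : (Finset.univ.filter fun x : Fin n → V => β ≤ metricCost c δ x).card <
          (Finset.univ.filter fun x : Fin n → V => α ≤ metricCost c δ x).card := by
        refine Finset.card_lt_card ⟨fun x hx => ?_, fun hsub => ?_⟩
        · simp only [Finset.mem_filter, Finset.mem_univ, true_and] at hx ⊢
          exact (show α ≤ metricCost c δ y from hy).trans (hβ.le.trans hx)
        · have := hsub (by simpa using hy : y ∈ _)
          simp only [Finset.mem_filter, Finset.mem_univ, true_and] at this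
          linarith
      have hy' : α ≤ metricCost c δ y := hy
      have h1 := ih _ hcard β a b ha hb (by linarith) (by linarith) rfl
      obtain ⟨x, hx, hFx, hax, hxb⟩ := P.improve hψ hc hB hβ' hb (by linarith) h1
      have h2 := Relation.ReflTransGen.head
        (⟨ha, hx, by linarith, hFx, hax⟩ : IsStep Γ ψ B (metricCost c δ) _ a x) hxb
      refine Relation.ReflTransGen.mono (fun p q hpq => ?_) _ _ h2
      have hlt : ∀ p, metricCost c δ p < metricCost c δ y → metricCost c δ p < α :=
        fun p hp => not_le.1 fun h => absurd hp (not_lt.2 (hmin p h))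
      exact ⟨hpq.mem, hpq.mem', hlt _ hpq.lt, hlt _ hpq.lt', hpq.comp⟩
    · push Not at hex
      exact P.graph.exists_steps hψ hB hex a b ha hb

/-- If a property holds for one of two minimizers in a box and not for the other, then this is so
for two comparable minimizers in the box. -/
theorem IsPositiveMetric.exists_comparable_minimizers (P : IsPositiveMetric Γ g δ)
    (hψ : IsHeight Γ ψ) (hc : ∀ e : Sym2 (V ⊕ Fin n), ¬ e.IsDiag → 0 ≤ c e)
    (hB : IsBoxConvex Γ B) {ι : Type*} (G : (Fin n → V) → ι) {a b : Fin n → V} (ha : a ∈ B)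
    (hb : b ∈ B) (hFa : ∀ x, metricCost c δ a ≤ metricCost c δ x)
    (hFb : ∀ x, metricCost c δ b ≤ metricCost c δ x) (hG : G a ≠ G b) :
    ∃ p ∈ B, ∃ q ∈ B, (∀ x, metricCost c δ p ≤ metricCost c δ x) ∧
      (∀ x, metricCost c δ q ≤ metricCost c δ x) ∧ G p ≠ G q ∧ ∀ i, Below Γ ψ (p i) (q i) := by
  -- Just above the minimum the sublevel set consists of the minimizers.
  obtain ⟨β, hβ, hβ'⟩ := exists_level (metricCost (V := V) c δ) (metricCost c δ a)
  have h := P.exists_steps hψ hc hB β a b ha hb hβ ((hFb a).trans_lt hβ)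
  have hmin : ∀ x, metricCost c δ x < β → ∀ y, metricCost c δ x ≤ metricCost c δ y :=
    fun x hx y => (hβ' x hx).trans (hFa y)
  by_contra hcon
  have hstep : ∀ p q, IsStep Γ ψ B (metricCost c δ) β p q → G p = G q := by
    intro p q hpq
    by_contra hne
    rcases hpq.comp with h1 | h1
    · exact hcon ⟨p, hpq.mem, q, hpq.mem', hmin p hpq.lt, hmin q hpq.lt', hne, h1⟩
    · exact hcon ⟨q, hpq.mem', p, hpq.mem, hmin q hpq.lt', hmin p hpq.lt, Ne.symm hne, h1⟩
  refine hG ?_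
  clear hFb hb hcon hG
  induction h with
  | refl => rfl
  | tail _ hpq ih => exact ih.trans (hstep _ _ hpq)

end

end ModularGraph

namespace ModularGraph

/-! ### Reversing an orbit and comparing two orders -/

variable {V : Type*} {Γ : SimpleGraph V}

/-- Two heights that differ by reversing the edges with `r = 1`. -/
structure IsFlip (Γ : SimpleGraph V) (r : V → V → ℝ) (ψ ψ' : V → ℝ) : Prop where
  left : IsHeight Γ ψ
  right : IsHeight Γ ψ'
  zero_or_one : ∀ u v, Γ.Adj u v → r u v = 0 ∨ r u v = 1
  sub_eq : ∀ u v, Γ.Adj u v → ψ' v - ψ' u = (1 - 2 * r u v) * (ψ v - ψ u)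

theorem IsFlip.symm {r : V → V → ℝ} {ψ ψ' : V → ℝ} (h : IsFlip Γ r ψ ψ') : IsFlip Γ r ψ' ψ := by
  refine ⟨h.right, h.left, h.zero_or_one, fun u v huv => ?_⟩
  rw [h.sub_eq u v huv]
  rcases h.zero_or_one u v huv with h1 | h1 <;> rw [h1] <;> ring

/-- Subtract twice the height weighted by `r`. -/
theorem IsHeight.exists_isFlip {ψ : V → ℝ} (hψ : IsHeight Γ ψ) (hΓ : IsConnectedModular Γ)
    {r : V → V → ℝ} (hr : SquareInvariant Γ r) (hsymm : ∀ u v, r u v = r v u)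
    (h01 : ∀ u v, Γ.Adj u v → r u v = 0 ∨ r u v = 1) : ∃ ψ', IsFlip Γ r ψ ψ' := by
  obtain ⟨χ, hχ⟩ := hψ.exists_weightedHeight hΓ hr hsymm
  have hsub : ∀ u v, Γ.Adj u v →
      (ψ v - 2 * χ v) - (ψ u - 2 * χ u) = (1 - 2 * r u v) * (ψ v - ψ u) := by
    intro u v huv
    have := hχ u v huv
    linear_combination -2 * this
  refine ⟨fun x => ψ x - 2 * χ x, hψ, ⟨fun u v huv => ?_, fun u v v' u' hc => ?_⟩, h01, hsub⟩
  · have h1 := hsub u v huv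
    rcases h01 u v huv with h2 | h2 <;> rcases hψ.adj u v huv with h3 | h3 <;>
      rw [h2, h3] at h1
    · left; linarith
    · right; linarith
    · right; linarith
    · left; linarith
  · rw [hsub u v hc.1, hsub u' v' hc.2.2.1.symm, hr _ _ _ _ hc, hψ.square _ _ _ _ hc]

/-- A shortest path from `x` to `y` rises at every step in both heights, so it uses only edges of
weight zero. -/
theorem IsGeodesicMetric.eq_zero (hΓ : IsConnectedModular Γ) {g δ : V → V → ℝ}
    (hδ : IsGeodesicMetric Γ g δ) {ψ ψ' : V → ℝ} (hψ : IsHeight Γ ψ) (hψ' : IsHeight Γ ψ')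
    (hg : ∀ u v, Γ.Adj u v → ψ v = ψ u + 1 → ψ' v = ψ' u + 1 → g u v = 0) {x y : V}
    (h : Below Γ ψ x y) (h' : Below Γ ψ' x y) : δ x y = 0 := by
  induction hn : Γ.dist x y generalizing x with
  | zero => rw [hΓ.eq_of_dist hn, hδ.self]
  | succ n ih =>
    have hne : x ≠ y := by
      rintro rfl
      simp at hn
    obtain ⟨v, hxv, hd⟩ := hΓ.exists_neighbor hne
    have hb := IsConnectedModular.btw_of_adj hxv hd
    obtain ⟨h1, h2⟩ := hψ.below_of_btw hΓ h hb
    obtain ⟨h1', h2'⟩ := hψ'.below_of_btw hΓ h' hb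
    rw [hδ.btw _ _ _ hb, hδ.adj _ _ hxv, ih h2 h2' (by omega),
      hg _ _ hxv (IsHeight.adj_height hxv h1) (IsHeight.adj_height hxv h1'), add_zero]

section

variable [Fintype V] {n : ℕ} {c : Sym2 (V ⊕ Fin n) → ℚ}

theorem metricCost_congr {δ g : V → V → ℝ} (hδ : IsGeodesicMetric Γ g δ) {p q : Fin n → V}
    (h : ∀ i, δ (p i) (q i) = 0) : metricCost c δ p = metricCost c δ q := by
  have h0 : ∀ x : V ⊕ Fin n, δ (Sum.elim id p x) (Sum.elim id q x) = 0 := by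
    rintro (s | i)
    exacts [hδ.self _, h i]
  unfold metricCost
  congr 1
  funext x y
  have h1 := hδ.triangle (Sum.elim id p x) (Sum.elim id q x) (Sum.elim id p y)
  have h2 := hδ.triangle (Sum.elim id q x) (Sum.elim id q y) (Sum.elim id p y)
  have h3 := hδ.triangle (Sum.elim id q x) (Sum.elim id p x) (Sum.elim id q y)
  have h4 := hδ.triangle (Sum.elim id p x) (Sum.elim id p y) (Sum.elim id q y)
  rw [hδ.symm (Sum.elim id q y), h0] at h2
  rw [hδ.symm (Sum.elim id q x) (Sum.elim id p x), h0] at h3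
  rw [h0] at h1 h4
  linarith

theorem metricCost_add_mul {δ δ₁ δ₂ : V → V → ℝ} {t : ℝ} (h : ∀ u v, δ u v = t * δ₁ u v + δ₂ u v)
    (ρ : Fin n → V) : metricCost c δ ρ = t * metricCost c δ₁ ρ + metricCost c δ₂ ρ := by
  unfold metricCost
  simp only [h]
  rw [pairSum_add, pairSum_mul]

variable {g δ r δ₁ δ₂ : V → V → ℝ} {t : ℝ}

/-- In a closest pair of comparable minimizers the values of the `r`-part agree. -/
theorem IsPositiveMetric.eq_of_closest (P : IsPositiveMetric Γ g δ)
    (hc : ∀ e : Sym2 (V ⊕ Fin n), ¬ e.IsDiag → 0 ≤ c e) (h₁ : IsGeodesicMetric Γ r δ₁)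
    (h₂ : IsGeodesicMetric Γ (fun u v => g u v - t * r u v) δ₂) (ht : 0 < t)
    (hr : ∀ u v, Γ.Adj u v → r u v = 1 → g u v = t)
    (hδ : ∀ u v, δ u v = t * δ₁ u v + δ₂ u v) {ψ ψ' : V → ℝ} (hflip : IsFlip Γ r ψ ψ')
    {p q : Fin n → V} (hp : ∀ x, metricCost c δ p ≤ metricCost c δ x)
    (hq : ∀ x, metricCost c δ q ≤ metricCost c δ x) (hpq : ∀ i, Below Γ ψ (p i) (q i))
    (hmin : ∀ p' q' : Fin n → V, (∀ x, metricCost c δ p' ≤ metricCost c δ x) →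
      (∀ x, metricCost c δ q' ≤ metricCost c δ x) → (∀ i, Below Γ ψ' (p' i) (q' i)) →
      metricCost c δ₁ p' ≠ metricCost c δ₁ q' →
      ∑ i, Γ.dist (p i) (q i) ≤ ∑ i, Γ.dist (p' i) (q' i)) :
    metricCost c δ₁ p = metricCost c δ₁ q := by
  by_contra hne
  have hΓ := P.graph
  let B : Set (Fin n → V) := {x | ∀ i, Below Γ ψ (p i) (x i) ∧ Below Γ ψ (x i) (q i)}
  have hB : IsBoxConvex Γ B := fun a ha b hb x hx i =>
    hflip.left.convex_Icc hΓ (p i) (q i) (a i) (ha i) (b i) (hb i) (x i) (hx i)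
  obtain ⟨p', hp'B, q', hq'B, hp', hq', hne', hpq'⟩ :=
    P.exists_comparable_minimizers hflip.right hc hB (metricCost c δ₁)
      (show p ∈ B from fun i => ⟨below_refl _ _, hpq i⟩)
      (show q ∈ B from fun i => ⟨hpq i, below_refl _ _⟩) hp hq hne
  have hsum := hmin p' q' hp' hq' hpq' hne'
  have hbtw : ∀ i, Btw Γ (p i) (p' i) (q i) ∧ Btw Γ (p i) (q' i) (q i) := fun i =>
    ⟨(hflip.left.below_trans hΓ (hp'B i).1 (hp'B i).2).2,
      (hflip.left.below_trans hΓ (hq'B i).1 (hq'B i).2).2⟩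
  have hle : ∀ i, Γ.dist (p' i) (q' i) ≤ Γ.dist (p i) (q i) := by
    intro i
    obtain ⟨b1, b2⟩ := hbtw i
    have t1 := hΓ.triangle (p' i) (p i) (q' i)
    have t2 := hΓ.triangle (p' i) (q i) (q' i)
    have e1 := Γ.dist_comm (u := p' i) (v := p i)
    have e2 := Γ.dist_comm (u := q' i) (v := q i)
    unfold Btw at b1 b2
    omega
  -- Both new points lie in the interval from `p i` to `q i`, so they are no farther apart
  -- coordinatewise; minimality of the total distance forces equality. The interval inequalities
  -- then put `p i` and `q i` between `p' i` and `q' i`.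
  have heq : ∀ i, Γ.dist (p' i) (q' i) = Γ.dist (p i) (q i) := by
    have := (Finset.sum_eq_sum_iff_of_le fun i _ => hle i).1
      (le_antisymm (Finset.sum_le_sum fun i _ => hle i) hsum)
    exact fun i => this i (Finset.mem_univ i)
  have hin : ∀ i, Btw Γ (p' i) (p i) (q' i) ∧ Btw Γ (p' i) (q i) (q' i) := by
    intro i
    obtain ⟨b1, b2⟩ := hbtw i
    have t1 := hΓ.triangle (p' i) (p i) (q' i)
    have t2 := hΓ.triangle (p' i) (q i) (q' i)
    have e1 := Γ.dist_comm (u := p' i) (v := p i)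
    have e2 := Γ.dist_comm (u := q' i) (v := q i)
    have e3 := heq i
    unfold Btw at *
    omega
  -- From `p` to `p'` paths rise in ψ and fall in ψ', so only reversed edges occur, and these have
  -- no `δ₂`-length.
  have hN : metricCost c δ₂ p = metricCost c δ₂ p' := by
    refine metricCost_congr h₂ fun i => ?_
    refine h₂.eq_zero hΓ hflip.left hflip.right.neg ?_ (hp'B i).1
      (below_neg.2 (hflip.right.below_of_btw hΓ (hpq' i) (hin i).1).1)
    intro u v huv h3 h4
    have h5 := hflip.sub_eq u v huv
    simp only [Pi.neg_apply] at h4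
    have h6 : r u v = 1 := by
      rcases hflip.zero_or_one u v huv with h | h
      · rw [h, h3] at h5
        linarith
      · exact h
    simp only [hr u v huv h6, h6]
    ring
  -- From `p'` to `q` paths rise in both heights, so no reversed edge occurs.
  have hR : metricCost c δ₁ p' = metricCost c δ₁ q := by
    refine metricCost_congr h₁ fun i => ?_
    refine h₁.eq_zero hΓ hflip.left hflip.right ?_ (hp'B i).2
      (hflip.right.below_of_btw hΓ (hpq' i) (hin i).2).1
    intro u v huv h3 h4
    have h5 := hflip.sub_eq u v huv
    rcases hflip.zero_or_one u v huv with h | h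
    · exact h
    · rw [h, h3] at h5
      linarith
  have h3 := le_antisymm (hp p') (hp' p)
  rw [metricCost_add_mul hδ, metricCost_add_mul hδ, hN] at h3
  have h4 : metricCost c δ₁ p = metricCost c δ₁ p' := mul_left_cancel₀ ht.ne' (by linarith)
  exact hne (h4.trans hR)

/-- The `r`-part of the location function is constant on the set of minimizers. -/
theorem IsPositiveMetric.metricCost_eq (P : IsPositiveMetric Γ g δ)
    (hc : ∀ e : Sym2 (V ⊕ Fin n), ¬ e.IsDiag → 0 ≤ c e) (h₁ : IsGeodesicMetric Γ r δ₁)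
    (h₂ : IsGeodesicMetric Γ (fun u v => g u v - t * r u v) δ₂) (ht : 0 < t)
    (hr : ∀ u v, Γ.Adj u v → r u v = 1 → g u v = t)
    (hδ : ∀ u v, δ u v = t * δ₁ u v + δ₂ u v) {ψ ψ' : V → ℝ} (hflip : IsFlip Γ r ψ ψ')
    {p q : Fin n → V} (hp : ∀ x, metricCost c δ p ≤ metricCost c δ x)
    (hq : ∀ x, metricCost c δ q ≤ metricCost c δ x) :
    metricCost c δ₁ p = metricCost c δ₁ q := by
  by_contra hne
  -- Pairs for both heights compete for the minimum, because the pair found inside the box is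
  -- comparable for the other height.
  let S : Set ((Fin n → V) × (Fin n → V)) := {z |
    (∀ x, metricCost c δ z.1 ≤ metricCost c δ x) ∧
    (∀ x, metricCost c δ z.2 ≤ metricCost c δ x) ∧ metricCost c δ₁ z.1 ≠ metricCost c δ₁ z.2 ∧
    ((∀ i, Below Γ ψ (z.1 i) (z.2 i)) ∨ ∀ i, Below Γ ψ' (z.1 i) (z.2 i))}
  have hS : S.Nonempty := by
    obtain ⟨p', -, q', -, h⟩ := P.exists_comparable_minimizers hflip.left hc
      (B := Set.univ) (fun _ _ _ _ _ _ => trivial) (metricCost c δ₁) trivial trivial hp hq hne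
    exact ⟨(p', q'), h.1, h.2.1, h.2.2.1, Or.inl h.2.2.2⟩
  obtain ⟨⟨a, b⟩, ⟨ha, hb, hab, hcomp⟩, hmin⟩ := Set.exists_min_image S
    (fun z => ∑ i, Γ.dist (z.1 i) (z.2 i)) (Set.toFinite S) hS
  rcases hcomp with h | h
  · exact hab (P.eq_of_closest hc h₁ h₂ ht hr hδ hflip ha hb h
      fun p' q' hp' hq' h3 h4 => hmin (p', q') ⟨hp', hq', h4, Or.inr h3⟩)
  · exact hab (P.eq_of_closest hc h₁ h₂ ht hr hδ hflip.symm ha hb h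
      fun p' q' hp' hq' h3 h4 => hmin (p', q') ⟨hp', hq', h4, Or.inl h3⟩)

end

end ModularGraph

namespace ModularGraph

/-! ### Decomposition of the edge-length into orbits -/

variable {V : Type*} {Γ : SimpleGraph V}

theorem IsOpposite.symm {e e' : Γ.edgeSet} (h : IsOpposite Γ e e') : IsOpposite Γ e' e := by
  obtain ⟨u, v, v', u', hc, h1, h2⟩ := h
  exact ⟨u', v', v, u, hc.reverse, h2, h1⟩

theorem IsProjective.symm {e e' : Γ.edgeSet} (h : IsProjective Γ e e') : IsProjective Γ e' e := by
  induction h with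
  | refl => exact .refl
  | tail _ h ih => exact Relation.ReflTransGen.head h.symm ih

theorem IsGeodesicMetric.eq_of_adj (hΓ : IsConnectedModular Γ) {g g' δ δ' : V → V → ℝ}
    (h : IsGeodesicMetric Γ g δ) (h' : IsGeodesicMetric Γ g' δ')
    (hg : ∀ u v, Γ.Adj u v → g u v = g' u v) (x y : V) : δ x y = δ' x y := by
  induction hn : Γ.dist x y generalizing x with
  | zero => rw [hΓ.eq_of_dist hn, h.self, h'.self]
  | succ n ih =>
    have hne : x ≠ y := by
      rintro rfl
      simp at hn
    obtain ⟨v, hxv, hd⟩ := hΓ.exists_neighbor hne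
    have hb := IsConnectedModular.btw_of_adj hxv hd
    rw [h.btw _ _ _ hb, h'.btw _ _ _ hb, h.adj _ _ hxv, h'.adj _ _ hxv, hg _ _ hxv,
      ih v (by omega)]

theorem IsGeodesicMetric.add_mul {g₁ g₂ δ₁ δ₂ : V → V → ℝ} (h₁ : IsGeodesicMetric Γ g₁ δ₁)
    (h₂ : IsGeodesicMetric Γ g₂ δ₂) {t : ℝ} (ht : 0 ≤ t) :
    IsGeodesicMetric Γ (fun u v => t * g₁ u v + g₂ u v) fun u v => t * δ₁ u v + δ₂ u v where
  self u := by simp [h₁.self, h₂.self]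
  symm u v := by simp only [h₁.symm u v, h₂.symm u v]
  triangle u v w := by
    have := mul_le_mul_of_nonneg_left (h₁.triangle u v w) ht
    linarith [h₂.triangle u v w]
  btw a c b h := by
    simp only [h₁.btw a c b h, h₂.btw a c b h]
    ring
  adj u v h := by simp only [h₁.adj u v h, h₂.adj u v h]

theorem IsOrbitInvariant.add_mul {h₁ h₂ : Γ.edgeSet → ℝ} (hi₁ : IsOrbitInvariant Γ h₁)
    (hi₂ : IsOrbitInvariant Γ h₂) (t : ℝ) : IsOrbitInvariant Γ fun e => t * h₁ e + h₂ e := by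
  intro e e' he
  simp only [hi₁ e e' he, hi₂ e e' he]

/-- Both sides are additive along the same shortest paths and agree on edges. Infima over walks
alone would give only an inequality. -/
theorem weightedDist_add_mul (hΓ : IsConnectedModular Γ) {h₁ h₂ : Γ.edgeSet → ℝ}
    (hi₁ : IsOrbitInvariant Γ h₁) (hi₂ : IsOrbitInvariant Γ h₂) (hn₁ : ∀ e, 0 ≤ h₁ e)
    (hn₂ : ∀ e, 0 ≤ h₂ e) {t : ℝ} (ht : 0 ≤ t) (x y : V) :
    weightedDist Γ (fun e => t * h₁ e + h₂ e) x y =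
      t * weightedDist Γ h₁ x y + weightedDist Γ h₂ x y := by
  refine IsGeodesicMetric.eq_of_adj hΓ (weightedDist_isGeodesicMetric hΓ (hi₁.add_mul hi₂ t)
    fun e => add_nonneg (mul_nonneg ht (hn₁ e)) (hn₂ e))
    ((weightedDist_isGeodesicMetric hΓ hi₁ hn₁).add_mul
      (weightedDist_isGeodesicMetric hΓ hi₂ hn₂) ht) ?_ x y
  intro u v huv
  simp only [edgeWeight_of_adj _ huv]

/-- The indicator function of the orbit of `e`. -/
noncomputable def orbitIndicator (e f : Γ.edgeSet) : ℝ :=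
  open Classical in if IsProjective Γ e f then 1 else 0

theorem orbitIndicator_invariant (e : Γ.edgeSet) : IsOrbitInvariant Γ (orbitIndicator e) := by
  intro f f' h
  have : IsProjective Γ e f ↔ IsProjective Γ e f' :=
    ⟨fun h1 => h1.trans h, fun h1 => h1.trans h.symm⟩
  unfold orbitIndicator
  by_cases h1 : IsProjective Γ e f
  · rw [if_pos h1, if_pos (this.1 h1)]
  · rw [if_neg h1, if_neg (mt this.2 h1)]

theorem orbitIndicator_eq (e f : Γ.edgeSet) :
    orbitIndicator e f = 0 ∨ orbitIndicator e f = 1 := by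
  unfold orbitIndicator
  split_ifs <;> simp

theorem orbitIndicator_nonneg (e f : Γ.edgeSet) : 0 ≤ orbitIndicator e f := by
  rcases orbitIndicator_eq e f with h | h <;> rw [h]
  exact zero_le_one

theorem orbitIndicator_self (e : Γ.edgeSet) : orbitIndicator e e = 1 :=
  if_pos .refl

theorem IsOrbitInvariant.eq_of_orbitIndicator {h : Γ.edgeSet → ℝ} (hi : IsOrbitInvariant Γ h)
    {e f : Γ.edgeSet} (hef : orbitIndicator e f = 1) : h f = h e := by
  refine (hi e f ?_).symm
  by_contra hne
  rw [orbitIndicator, if_neg hne] at hef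
  exact zero_ne_one hef

/-- The remainder of `h` outside the orbit of `e`. -/
noncomputable def orbitRemainder (h : Γ.edgeSet → ℝ) (e f : Γ.edgeSet) : ℝ :=
  -h e * orbitIndicator e f + h f

theorem IsOrbitInvariant.orbitRemainder {h : Γ.edgeSet → ℝ} (hi : IsOrbitInvariant Γ h)
    (e : Γ.edgeSet) : IsOrbitInvariant Γ (orbitRemainder h e) :=
  (orbitIndicator_invariant e).add_mul hi _

theorem IsOrbitInvariant.orbitRemainder_eq {h : Γ.edgeSet → ℝ} (hi : IsOrbitInvariant Γ h)
    (e f : Γ.edgeSet) : ModularGraph.orbitRemainder h e f = 0 ∨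
      ModularGraph.orbitRemainder h e f = h f := by
  rcases orbitIndicator_eq e f with h1 | h1
  · right
    simp [ModularGraph.orbitRemainder, h1]
  · left
    simp [ModularGraph.orbitRemainder, h1, hi.eq_of_orbitIndicator h1]

theorem IsOrbitInvariant.orbitRemainder_nonneg {h : Γ.edgeSet → ℝ} (hi : IsOrbitInvariant Γ h)
    (hn : ∀ e, 0 ≤ h e) (e f : Γ.edgeSet) : 0 ≤ ModularGraph.orbitRemainder h e f := by
  rcases hi.orbitRemainder_eq e f with h1 | h1 <;> rw [h1]
  exact hn f

theorem weightedDist_eq_orbit (hΓ : IsConnectedModular Γ) {h : Γ.edgeSet → ℝ}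
    (hi : IsOrbitInvariant Γ h) (hn : ∀ e, 0 ≤ h e) (e : Γ.edgeSet) (x y : V) :
    weightedDist Γ h x y = h e * weightedDist Γ (orbitIndicator e) x y +
      weightedDist Γ (orbitRemainder h e) x y := by
  rw [← weightedDist_add_mul hΓ (orbitIndicator_invariant e) (hi.orbitRemainder e)
    (orbitIndicator_nonneg e) (hi.orbitRemainder_nonneg hn e) (hn e)]
  congr 1
  funext f
  simp [orbitRemainder]

theorem isPositiveMetric_weightedDist (hΓ : IsConnectedModular Γ) {h : Γ.edgeSet → ℝ}
    (hi : IsOrbitInvariant Γ h) (hpos : ∀ e, 0 < h e) :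
    IsPositiveMetric Γ (edgeWeight Γ h) (weightedDist Γ h) :=
  ⟨hΓ, hi.squareInvariant, edgeWeight_symm h, fun u v huv => by
    rw [edgeWeight_of_adj h huv]
    exact hpos _, weightedDist_isGeodesicMetric hΓ hi fun e => (hpos e).le⟩

variable [Fintype V] {n : ℕ} {c : Sym2 (V ⊕ Fin n) → ℚ}

/-- On the minimizers for a positive edge-length, the part of each orbit is constant. -/
theorem metricCost_orbitIndicator_eq (hΓ : IsConnectedModular Γ) (ho : IsOrientable Γ)
    (hc : ∀ e : Sym2 (V ⊕ Fin n), ¬ e.IsDiag → 0 ≤ c e) {h : Γ.edgeSet → ℝ}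
    (hi : IsOrbitInvariant Γ h) (hpos : ∀ e, 0 < h e) {p q : Fin n → V}
    (hp : IsOptimalLocation Γ h c p) (hq : IsOptimalLocation Γ h c q) (e : Γ.edgeSet) :
    metricCost c (weightedDist Γ (orbitIndicator e)) p =
      metricCost c (weightedDist Γ (orbitIndicator e)) q := by
  obtain ⟨ψ, hψ⟩ := exists_height hΓ ho
  have hn : ∀ e, 0 ≤ h e := fun e => (hpos e).le
  have hi₁ := orbitIndicator_invariant e
  have h01 : ∀ u v, Γ.Adj u v → edgeWeight Γ (orbitIndicator e) u v = 0 ∨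
      edgeWeight Γ (orbitIndicator e) u v = 1 := fun u v huv => by
    rw [edgeWeight_of_adj _ huv]
    exact orbitIndicator_eq _ _
  obtain ⟨ψ', hflip⟩ := hψ.exists_isFlip hΓ hi₁.squareInvariant (edgeWeight_symm _) h01
  have h₂ := weightedDist_isGeodesicMetric hΓ (hi.orbitRemainder e) (hi.orbitRemainder_nonneg hn e)
  have hw : edgeWeight Γ (orbitRemainder h e) =
      fun u v => edgeWeight Γ h u v - h e * edgeWeight Γ (orbitIndicator e) u v := by
    funext u v
    by_cases huv : Γ.Adj u v
    · simp only [edgeWeight_of_adj _ huv, orbitRemainder]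
      ring
    · simp [edgeWeight, huv]
  rw [hw] at h₂
  refine (isPositiveMetric_weightedDist hΓ hi hpos).metricCost_eq hc
    (weightedDist_isGeodesicMetric hΓ hi₁ (orbitIndicator_nonneg e)) h₂ (hpos e) ?_
    (weightedDist_eq_orbit hΓ hi hn e) hflip hp hq
  intro u v huv h1
  rw [edgeWeight_of_adj _ huv] at h1 ⊢
  exact hi.eq_of_orbitIndicator h1

/-- On the minimizers for a positive edge-length, the location function of every orbit-invariant
edge-length is constant. -/
theorem locationCost_eq_of_optimal (hΓ : IsConnectedModular Γ) (ho : IsOrientable Γ)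
    (hc : ∀ e : Sym2 (V ⊕ Fin n), ¬ e.IsDiag → 0 ≤ c e) {k : Γ.edgeSet → ℝ}
    (hk : IsOrbitInvariant Γ k) (hpos : ∀ e, 0 < k e) {p q : Fin n → V}
    (hp : IsOptimalLocation Γ k c p) (hq : IsOptimalLocation Γ k c q) (h : Γ.edgeSet → ℝ)
    (hi : IsOrbitInvariant Γ h) (hn : ∀ e, 0 ≤ h e) :
    locationCost Γ h c p = locationCost Γ h c q := by
  classical
  induction hs : {e | h e ≠ 0}.ncard using Nat.strong_induction_on generalizing h with
  | _ s ih =>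
    subst hs
    by_cases hex : ∃ e, h e ≠ 0
    · obtain ⟨e, he⟩ := hex
      -- Removing the orbit of `e` shrinks the support, so orbits are peeled off one at a time.
      have hsub : {f | orbitRemainder h e f ≠ 0} ⊂ {f | h f ≠ 0} := by
        refine ⟨fun f hf => ?_, fun hsub => ?_⟩
        · rcases hi.orbitRemainder_eq e f with h1 | h1
          · exact absurd h1 hf
          · exact fun h0 => hf (h1.trans h0)
        · exact hsub he (by simp [orbitRemainder, orbitIndicator_self])
      have h1 := ih _ (Set.ncard_lt_ncard hsub (Set.toFinite _)) _ (hi.orbitRemainder e)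
        (hi.orbitRemainder_nonneg hn e) rfl
      rw [locationCost_eq, locationCost_eq] at h1 ⊢
      rw [metricCost_add_mul (weightedDist_eq_orbit hΓ hi hn e),
        metricCost_add_mul (weightedDist_eq_orbit hΓ hi hn e), h1,
        metricCost_orbitIndicator_eq hΓ ho hc hk hpos hp hq e]
    · push Not at hex
      have hG := weightedDist_isGeodesicMetric hΓ hi hn
      have h0 : ∀ x y, weightedDist Γ h x y = 0 := by
        intro x y
        refine hG.eq_of_adj hΓ (g' := fun _ _ => 0) (δ' := fun _ _ => 0)
          ⟨by simp, by simp, by simp, by simp, by simp⟩ ?_ x y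
        intro u v huv
        rw [edgeWeight_of_adj h huv, hex]
      rw [locationCost_eq, locationCost_eq]
      simp only [metricCost, h0]

end ModularGraph

/-! ### Perturbing the unit length -/

theorem mainTheorem9 {V : Type*} [Fintype V] (Γ : SimpleGraph V) (hconn : Γ.Connected)
    (hmod : ModularGraph.IsModular Γ) (hor : ModularGraph.IsOrientable Γ)
    (n : ℕ) (c : Sym2 (V ⊕ Fin n) → ℚ) (hc : ∀ e : Sym2 (V ⊕ Fin n), ¬ e.IsDiag → 0 ≤ c e)
    (h : Γ.edgeSet → ℝ) (hinv : ModularGraph.IsOrbitInvariant Γ h)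
    (hnonneg : ∀ e : Γ.edgeSet, 0 ≤ h e)
    (ρ : Fin n → V) (hρ : ModularGraph.IsOptimalLocation Γ (fun _ => 1) c ρ) :
    ModularGraph.IsOptimalLocation Γ h c ρ := by
  open ModularGraph in
  have hΓ : IsConnectedModular Γ := ⟨hconn, hmod⟩
  set F₁ := locationCost Γ (fun _ => 1) c with hF₁
  set F := locationCost Γ h c with hF
  by_contra hcon
  obtain ⟨σ₀, hσ₀⟩ : ∃ σ, F σ < F ρ := by
    unfold IsOptimalLocation at hcon
    push Not at hcon
    exact hcon
  -- The quotient is the weight on `h` at which a competitor catches up with ρ. The first to do so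
  -- ties with ρ while no other location has yet overtaken it.
  obtain ⟨σ, hσ, hmin⟩ := Set.exists_min_image {σ | F σ < F ρ}
    (fun σ => (F₁ σ - F₁ ρ) / (F ρ - F σ)) (Set.toFinite _) ⟨σ₀, hσ₀⟩
  have hσ' : 0 < F ρ - F σ := sub_pos.2 hσ
  set t := (F₁ σ - F₁ ρ) / (F ρ - F σ) with ht
  have ht0 : 0 ≤ t := div_nonneg (sub_nonneg.2 (hρ σ)) hσ'.le
  have hi₁ : IsOrbitInvariant Γ (fun _ => (1 : ℝ)) := fun _ _ _ => rfl
  have hcost : ∀ τ, locationCost Γ (fun e => t * h e + 1) c τ = t * F τ + F₁ τ := fun τ =>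
    metricCost_add_mul (weightedDist_add_mul hΓ hinv hi₁ hnonneg (fun _ => zero_le_one) ht0) τ
  have heq : t * F σ + F₁ σ = t * F ρ + F₁ ρ := by
    have := div_mul_cancel₀ (F₁ σ - F₁ ρ) hσ'.ne'
    rw [← ht] at this
    linarith
  have hoptρ : IsOptimalLocation Γ (fun e => t * h e + 1) c ρ := by
    intro τ
    rw [hcost, hcost]
    rcases lt_or_ge (F τ) (F ρ) with hτ | hτ
    · have h1 : t ≤ (F₁ τ - F₁ ρ) / (F ρ - F τ) := hmin τ hτ
      rw [le_div_iff₀ (sub_pos.2 hτ)] at h1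
      linarith
    · have h1 : F₁ ρ ≤ F₁ τ := hρ τ
      have h2 := mul_le_mul_of_nonneg_left hτ ht0
      linarith
  have hoptσ : IsOptimalLocation Γ (fun e => t * h e + 1) c σ := by
    intro τ
    have := hoptρ τ
    rw [hcost, hcost] at *
    linarith
  -- The summand 1 makes the combined length positive even where `h` vanishes, as constancy on the
  -- minimizers requires.
  have := locationCost_eq_of_optimal hΓ hor hc (hinv.add_mul hi₁ t)
    (fun e => by have := mul_nonneg ht0 (hnonneg e); linarith) hoptσ hoptρ h hinv hnonneg
  exact hσ.ne this
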